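/- Fix dimensions $d_x \ge 1$, $d_u$, and cost matrices $R_x \succeq I$ (symmetric, $d_x\times d_x$) and $R_u = I$ ($d_u \times d_u$). Consider the linear system $x_{t+1} = A x_t + B u_t + w_t$ with $x_1 = 0$ and $w_t$ i.i.d. $\mathcal N(0,I)$. A real square matrix is stable if its spectral radius is less than $1$; $(A,B)$ is stabilizable if $A+BK$ is stable for some $K$. For stabilizable $(A,B)$ let $P_\infty(A,B)$ be the unique positive semidefinite solution of the Riccati equation $$P = A^\top P A - A^\top P B (R_u + B^\top P B)^{-1} B^\top P A + R_x,$$ and let $K_\infty(A,B) = -(R_u + B^\top P_\infty(A,B) B)^{-1} B^\top P_\infty(A,B) A$. For a matrix $K$ let $$J_{A,B}[K] = \lim_{T\to\infty} \frac1T\, \mathbb E \sum_{t=1}^T \left(x_t^\top R_x x_t + u_t^\top R_u u_t\right) \quad\text{under } u_t = K x_t,$$ let $J^\star_{A,B} = \min_K J_{A,B}[K]$, and, when $A+BK$ is stable, let $P_\infty(K;A,B)$ be the unique positive semidefinite solution $P$ of $P = (A+BK)^\top P (A+BK) + R_x + K^\top R_u K$. Write $\|\cdot\|_{\mathrm{op}}$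 for the spectral norm, $\|\cdot\|_F$ for the Frobenius norm and $\preceq$ for the Loewner order. Theorem. There is a universal constant $C>0$ such that the following holds for all such $d_x, d_u, R_x$. Let $(A_\star,B_\star)$ be stabilizable, $P_\star = P_\infty(A_\star,B_\star)$, $K_\star = K_\infty(A_\star,B_\star)$, let $(\hat A,\hat B)$ be any pair of matrices of the same sizes, and for $\circ \in \{\mathrm{op},F\}$ put $\epsilon_\circ = \max\{\|\hat A - A_\star\|_\circ, \|\hat B - B_\star\|_\circ\}$. Assume $\epsilon_{\mathrm{op}} \le 1/(54\|P_\star\|_{\mathrm{op}}^5)$. Then $(\hat A,\hat B)$ is stabilizable and, with $\hat K = K_\infty(\hat A,\hat B)$, the matrix $A_\star + B_\star \hat K$ is stable (so that all objects below are well defined), and: 1. $\|P_\infty(\hat A,\hat B)\|_{\mathrm{op}} \le 1.0835\,\|P_\star\|_{\mathrm{op}}$, $\ \|B_\star(K_\star - \hat K)\|_{\mathrm{op}} < \dfrac{1}{5\|P_\star\|_{\mathrm{op}}^{3/2}}$, and $\|K_\star - \hat K\|_{\mathrm{op}} \le \dfrac{C}{\|P_\star\|_{\mathrm{op}}^{3/2}}$;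 2. $J_{A_\star,B_\star}[\hat K] - J^\star_{A_\star,B_\star} \le 142\,\|P_\star\|_{\mathrm{op}}^8\, \epsilon_F^2$; 3. $\|P_\infty(\hat K;A_\star,B_\star) - P_\star\|_{\mathrm{op}} \le 142\,\|P_\star\|_{\mathrm{op}}^8\, \epsilon_{\mathrm{op}}^2$; 4. $P_\infty(\hat K;A_\star,B_\star) \preceq \tfrac{21}{20} P_\star$. -/

import Mathlib

open MeasureTheory ProbabilityTheory Filter Topology
open scoped Matrix

namespace LQR

/-- The spectral norm (`ℓ²`-operator norm) of a real matrix. -/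
noncomputable def opNorm {a b : ℕ} (M : Matrix (Fin a) (Fin b) ℝ) : ℝ :=
  open scoped Matrix.Norms.L2Operator in ‖M‖

/-- The Frobenius norm of a real matrix. -/
noncomputable def frobNorm {a b : ℕ} (M : Matrix (Fin a) (Fin b) ℝ) : ℝ :=
  open scoped Matrix.Norms.Frobenius in ‖M‖

/-- The Loewner order `X ⪯ Y`: the difference `Y - X` is symmetric positive semidefinite. -/
def LoewnerLE {a : ℕ} (X Y : Matrix (Fin a) (Fin a) ℝ) : Prop :=
  (Y - X).PosSemidef

/-- A real square matrix is stable if its spectral radius (over its complex eigenvalues)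
is less than one. -/
def IsStable {a : ℕ} (M : Matrix (Fin a) (Fin a) ℝ) : Prop :=
  spectralRadius ℂ (M.map (fun x : ℝ => (x : ℂ))) < 1

/-- `(A, B)` is stabilizable if `A + B K` is stable for some feedback matrix `K`. -/
def Stabilizable {dx du : ℕ} (A : Matrix (Fin dx) (Fin dx) ℝ)
    (B : Matrix (Fin dx) (Fin du) ℝ) : Prop :=
  ∃ K : Matrix (Fin du) (Fin dx) ℝ, IsStable (A + B * K)

/-- `P` is a positive semidefinite solution of the discrete algebraic Riccati equation. -/
def IsDARESolution {dx du : ℕ} (Rx : Matrix (Fin dx) (Fin dx) ℝ)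
    (Ru : Matrix (Fin du) (Fin du) ℝ) (A : Matrix (Fin dx) (Fin dx) ℝ)
    (B : Matrix (Fin dx) (Fin du) ℝ) (P : Matrix (Fin dx) (Fin dx) ℝ) : Prop :=
  P.PosSemidef ∧
    P = Aᵀ * P * A - Aᵀ * P * B * (Ru + Bᵀ * P * B)⁻¹ * Bᵀ * P * A + Rx

/-- `P_∞(A, B)`: the positive semidefinite solution of the Riccati equation
(an arbitrary matrix if there is none). -/
noncomputable def Pinf {dx du : ℕ} (Rx : Matrix (Fin dx) (Fin dx) ℝ)
    (Ru : Matrix (Fin du) (Fin du) ℝ) (A : Matrix (Fin dx) (Fin dx) ℝ)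
    (B : Matrix (Fin dx) (Fin du) ℝ) : Matrix (Fin dx) (Fin dx) ℝ :=
  Classical.epsilon (IsDARESolution Rx Ru A B)

/-- `K_∞(A, B) = -(R_u + Bᵀ P_∞ B)⁻¹ Bᵀ P_∞ A`, the optimal infinite-horizon controller. -/
noncomputable def Kinf {dx du : ℕ} (Rx : Matrix (Fin dx) (Fin dx) ℝ)
    (Ru : Matrix (Fin du) (Fin du) ℝ) (A : Matrix (Fin dx) (Fin dx) ℝ)
    (B : Matrix (Fin dx) (Fin du) ℝ) : Matrix (Fin du) (Fin dx) ℝ :=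
  -((Ru + Bᵀ * Pinf Rx Ru A B * B)⁻¹ * Bᵀ * Pinf Rx Ru A B * A)

/-- `P` is a positive semidefinite solution of the discrete Lyapunov equation
`P = Xᵀ P X + Y`. -/
def IsLyapunovSolution {a : ℕ} (X Y P : Matrix (Fin a) (Fin a) ℝ) : Prop :=
  P.PosSemidef ∧ P = Xᵀ * P * X + Y

/-- `dlyap(X, Y)`: the positive semidefinite solution of the discrete Lyapunov equation
(an arbitrary matrix if there is none); used for stable `X` and positive semidefinite `Y`. -/
noncomputable def dlyap {a : ℕ} (X Y : Matrix (Fin a) (Fin a) ℝ) : Matrix (Fin a) (Fin a) ℝ :=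
  Classical.epsilon (IsLyapunovSolution X Y)

/-- `P_∞(K; A, B) = dlyap(A + B K, R_x + Kᵀ R_u K)`, the value matrix of the controller `K`. -/
noncomputable def PinfOf {dx du : ℕ} (Rx : Matrix (Fin dx) (Fin dx) ℝ)
    (Ru : Matrix (Fin du) (Fin du) ℝ) (A : Matrix (Fin dx) (Fin dx) ℝ)
    (B : Matrix (Fin dx) (Fin du) ℝ) (K : Matrix (Fin du) (Fin dx) ℝ) :
    Matrix (Fin dx) (Fin dx) ℝ :=
  dlyap (A + B * K) (Rx + Kᵀ * Ru * K)

/-- The law of the noise sequence: independent vectors `w_t ∼ N(0, I)` in dimension `dx`. -/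
noncomputable def noiseLaw (dx : ℕ) : Measure (ℕ → Fin dx → ℝ) :=
  Measure.infinitePi fun _ : ℕ => Measure.pi fun _ : Fin dx => gaussianReal 0 1

/-- The closed-loop trajectory under `u = K x`, started at `0`:
`x ↦ A x + B (K x) + w`. Time is counted from `0`. -/
noncomputable def state {dx du : ℕ} (A : Matrix (Fin dx) (Fin dx) ℝ)
    (B : Matrix (Fin dx) (Fin du) ℝ) (K : Matrix (Fin du) (Fin dx) ℝ)
    (w : ℕ → Fin dx → ℝ) : ℕ → Fin dx → ℝ
  | 0 => 0
  | t + 1 => A *ᵥ state A B K w t + B *ᵥ (K *ᵥ state A B K w t) + w t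

/-- The stage cost `c(x, u) = xᵀ R_x x + uᵀ R_u u`. -/
def stageCost {dx du : ℕ} (Rx : Matrix (Fin dx) (Fin dx) ℝ)
    (Ru : Matrix (Fin du) (Fin du) ℝ) (x : Fin dx → ℝ) (u : Fin du → ℝ) : ℝ :=
  x ⬝ᵥ (Rx *ᵥ x) + u ⬝ᵥ (Ru *ᵥ u)

/-- `J_{A,B}[K] = J`: the expected average cost of the policy `u = K x` over the first `T` steps
converges to the real number `J` as `T → ∞`. (The integrand is a quadratic polynomial in finitely
many Gaussian variables, hence integrable. A policy of infinite cost has no such `J`.) -/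
def HasAverageCost {dx du : ℕ} (Rx : Matrix (Fin dx) (Fin dx) ℝ)
    (Ru : Matrix (Fin du) (Fin du) ℝ) (A : Matrix (Fin dx) (Fin dx) ℝ)
    (B : Matrix (Fin dx) (Fin du) ℝ) (K : Matrix (Fin du) (Fin dx) ℝ) (J : ℝ) : Prop :=
  Tendsto
    (fun T : ℕ => (1 / (T : ℝ)) *
      ∫ w, ∑ t ∈ Finset.range T,
        stageCost Rx Ru (state A B K w t) (K *ᵥ state A B K w t) ∂(noiseLaw dx))
    atTop (𝓝 J)

/-- `J⋆_{A,B} = J`: the number `J` is the minimum of `J_{A,B}[K]` over all feedback matrices `K`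
(those of infinite cost do not compete). -/
def IsOptimalCost {dx du : ℕ} (Rx : Matrix (Fin dx) (Fin dx) ℝ)
    (Ru : Matrix (Fin du) (Fin du) ℝ) (A : Matrix (Fin dx) (Fin dx) ℝ)
    (B : Matrix (Fin dx) (Fin du) ℝ) (J : ℝ) : Prop :=
  IsLeast {J' : ℝ | ∃ K : Matrix (Fin du) (Fin dx) ℝ, HasAverageCost Rx Ru A B K J'} J

end LQR

/-!
Inflating the value matrix `P` of `(A, B)` to `(1 - δ)⁻¹ P` turns it into a supersolution of the
policy evaluation equation of the same controller on any system nearby, so value iteration for the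
nearby system converges below it. This gives existence and a norm bound for the perturbed Riccati
solution `P'`; exchanging the two systems bounds the cost `V` of the perturbed controller `K'` on
the true system.

Both Riccati equations subtract to the exact identity
`P' - P = Lᵀ (P' - P) L' + Eᵀ P' L' + Lᵀ P E'`,
where `L`, `L'` are the closed loops and `E`, `E'` are linear in the perturbation. In the
coordinates of square roots of `P` and `P'`, both closed loops have squared norm at most
`1 - 1/p`, where `p` bounds `‖P‖` and `‖P'‖`. Solving for `P' - P` and inserting the result into
the formula for the controllers bounds `K - K'` to first order. Completing the square gives
`V - P = (A + B K')ᵀ (V - P) (A + B K') + (K - K')ᵀ (Ru + Bᵀ P B) (K - K')`,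
so the suboptimality is quadratic in `K - K'`. The bounds use only that the norm of a product is
at most the spectral norm of either factor times the norm of the other, so they hold for the
spectral and the Frobenius norm alike.
-/

namespace LQR

open scoped MatrixOrder

section LoewnerOrder

variable {m n : Type*}

theorem transpose_eq_of_nonneg {P : Matrix n n ℝ} (hP : 0 ≤ P) : Pᵀ = P := by
  simpa using (Matrix.nonneg_iff_posSemidef.1 hP).isHermitian.eq

theorem posDef_of_one_le [DecidableEq n] {P : Matrix n n ℝ} (h : 1 ≤ P) : P.PosDef := by
  simpa using Matrix.PosDef.one.add_posSemidef (Matrix.le_iff.1 h)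

theorem transpose_mul_self_nonneg [Fintype m] [Finite n] (X : Matrix m n ℝ) : 0 ≤ Xᵀ * X := by
  simpa using (Matrix.posSemidef_conjTranspose_mul_self X).nonneg

theorem transpose_mul_mul_nonneg [Fintype m] [Finite n] {P : Matrix m m ℝ}
    (hP : 0 ≤ P) (X : Matrix m n ℝ) : 0 ≤ Xᵀ * P * X := by
  simpa using ((Matrix.nonneg_iff_posSemidef.1 hP).conjTranspose_mul_mul_same X).nonneg

theorem transpose_mul_mul_mono [Fintype m] [Finite n] {P Q : Matrix m m ℝ} (h : P ≤ Q)
    (X : Matrix m n ℝ) : Xᵀ * P * X ≤ Xᵀ * Q * X := by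
  have := transpose_mul_mul_nonneg (sub_nonneg.2 h) X
  rwa [Matrix.mul_sub, Matrix.sub_mul, sub_nonneg] at this

instance [Finite n] : OrderClosedTopology (Matrix n n ℝ) := by
  cases nonempty_fintype n
  have hclosed : IsClosed {P : Matrix n n ℝ | 0 ≤ P} := by
    simp_rw [Matrix.nonneg_iff_posSemidef, Matrix.posSemidef_iff_dotProduct_mulVec,
      Matrix.IsHermitian, Set.ofPred_and, Set.ofPred_forall]
    exact (isClosed_eq (by fun_prop) continuous_id).inter
      (isClosed_iInter fun v => isClosed_le continuous_const (by fun_prop))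
  have hsub : Continuous fun p : Matrix n n ℝ × Matrix n n ℝ => p.2 - p.1 := by fun_prop
  refine ⟨?_⟩
  convert hclosed.preimage hsub using 1
  ext p
  exact (sub_nonneg (a := p.2) (b := p.1)).symm

theorem trace_mono [Fintype n] {P Q : Matrix n n ℝ} (h : P ≤ Q) : P.trace ≤ Q.trace :=
  OrderHomClass.mono (Matrix.tracePositiveLinearMap n ℝ ℝ) h

theorem le_iff_dotProduct [Fintype n] {P Q : Matrix n n ℝ} (hP : Pᵀ = P) (hQ : Qᵀ = Q) :
    P ≤ Q ↔ ∀ v, v ⬝ᵥ P *ᵥ v ≤ v ⬝ᵥ Q *ᵥ v := by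
  rw [Matrix.le_iff, Matrix.posSemidef_iff_dotProduct_mulVec]
  simp [Matrix.IsHermitian, hP, hQ, Matrix.sub_mulVec, dotProduct_sub]

theorem dotProduct_transpose_mul_self [Fintype m] [Fintype n] (X : Matrix m n ℝ) (v : n → ℝ) :
    v ⬝ᵥ (Xᵀ * X) *ᵥ v = (X *ᵥ v) ⬝ᵥ (X *ᵥ v) := by
  rw [← Matrix.mulVec_mulVec, Matrix.dotProduct_mulVec, Matrix.vecMul_transpose]

theorem exists_eq_transpose_mul_self [Fintype n] {P : Matrix n n ℝ} (hP : 0 ≤ P) :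
    ∃ S : Matrix n n ℝ, P = Sᵀ * S := by
  classical
  obtain ⟨S, hS⟩ := CStarAlgebra.nonneg_iff_eq_star_mul_self.mp hP
  exact ⟨S, by simpa [Matrix.star_eq_conjTranspose] using hS⟩

theorem isUnit_det_of_one_le [Fintype n] [DecidableEq n] {S : Matrix n n ℝ}
    (h : 1 ≤ Sᵀ * S) : IsUnit S.det := by
  have hdet := (Matrix.isUnit_iff_isUnit_det _).1 (posDef_of_one_le h).isUnit
  rw [Matrix.det_mul] at hdet
  exact isUnit_of_mul_isUnit_right hdet

theorem apply_eq_polarization [Fintype n] [DecidableEq n] {P : Matrix n n ℝ} (hP : Pᵀ = P)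
    (i j : n) :
    P i j = ((Pi.single i 1 + Pi.single j 1) ⬝ᵥ P *ᵥ (Pi.single i 1 + Pi.single j 1)
      - (Pi.single i 1 - Pi.single j 1) ⬝ᵥ P *ᵥ (Pi.single i 1 - Pi.single j 1)) / 4 := by
  have hij : P j i = P i j := congrFun₂ hP i j
  simp only [Matrix.mulVec_add, Matrix.mulVec_sub, add_dotProduct, sub_dotProduct, dotProduct_add,
    dotProduct_sub, Matrix.mulVec_single_one, single_one_dotProduct, Matrix.col_apply, hij]
  ring

theorem exists_tendsto_of_monotone [Finite n] {f : ℕ → Matrix n n ℝ} {U : Matrix n n ℝ}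
    (hf : Monotone f) (hf0 : 0 ≤ f 0) (hU : ∀ k, f k ≤ U) : ∃ P, Tendsto f atTop (𝓝 P) := by
  -- The quadratic forms converge by monotonicity, hence the entries do by polarization.
  classical
  cases nonempty_fintype n
  have hsymm (k : ℕ) : (f k)ᵀ = f k := transpose_eq_of_nonneg (hf0.trans (hf k.zero_le))
  have hUsymm : Uᵀ = U := transpose_eq_of_nonneg (hf0.trans (hU 0))
  have hform (v : n → ℝ) : ∃ l, Tendsto (fun k => v ⬝ᵥ f k *ᵥ v) atTop (𝓝 l) := by
    refine ⟨_, tendsto_atTop_ciSup (fun j k hjk => ?_) ⟨v ⬝ᵥ U *ᵥ v, ?_⟩⟩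
    · exact (le_iff_dotProduct (hsymm j) (hsymm k)).1 (hf hjk) v
    · rintro _ ⟨k, rfl⟩
      exact (le_iff_dotProduct (hsymm k) hUsymm).1 (hU k) v
  choose l hl using hform
  let e (i : n) : n → ℝ := Pi.single i 1
  refine ⟨Matrix.of fun i j => (l (e i + e j) - l (e i - e j)) / 4, ?_⟩
  refine tendsto_pi_nhds.2 fun i => tendsto_pi_nhds.2 fun j => ?_
  simp_rw [apply_eq_polarization (hsymm _)]
  exact ((hl (e i + e j)).sub (hl (e i - e j))).div_const 4

end LoewnerOrder

section Norms

variable {a b c : ℕ}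

theorem opNorm_nonneg (X : Matrix (Fin a) (Fin b) ℝ) : 0 ≤ opNorm X := by
  open scoped Matrix.Norms.L2Operator in exact norm_nonneg X

theorem opNorm_mul_le (X : Matrix (Fin a) (Fin b) ℝ) (Y : Matrix (Fin b) (Fin c) ℝ) :
    opNorm (X * Y) ≤ opNorm X * opNorm Y :=
  Matrix.l2_opNorm_mul X Y

theorem opNorm_add_le (X Y : Matrix (Fin a) (Fin b) ℝ) :
    opNorm (X + Y) ≤ opNorm X + opNorm Y := by
  open scoped Matrix.Norms.L2Operator in exact norm_add_le X Y

theorem opNorm_sub_rev (X Y : Matrix (Fin a) (Fin b) ℝ) : opNorm (X - Y) = opNorm (Y - X) := by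
  open scoped Matrix.Norms.L2Operator in exact norm_sub_rev X Y

theorem opNorm_smul (r : ℝ) (X : Matrix (Fin a) (Fin b) ℝ) : opNorm (r • X) = |r| * opNorm X := by
  open scoped Matrix.Norms.L2Operator in exact norm_smul r X

theorem opNorm_transpose (X : Matrix (Fin a) (Fin b) ℝ) : opNorm Xᵀ = opNorm X := by
  rw [← Matrix.conjTranspose_eq_transpose_of_trivial]
  exact Matrix.l2_opNorm_conjTranspose X

theorem opNorm_transpose_mul_self (X : Matrix (Fin a) (Fin b) ℝ) :
    opNorm (Xᵀ * X) = opNorm X ^ 2 := by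
  rw [← Matrix.conjTranspose_eq_transpose_of_trivial, sq]
  exact Matrix.l2_opNorm_conjTranspose_mul_self X

theorem norm_toLp_sq (v : Fin a → ℝ) : ‖WithLp.toLp 2 v‖ ^ 2 = v ⬝ᵥ v := by
  rw [EuclideanSpace.norm_sq_eq]
  simp [dotProduct, sq]

theorem opNorm_le_of_transpose_mul_self_le {X : Matrix (Fin a) (Fin b) ℝ} {r : ℝ} (hr : 0 ≤ r)
    (h : Xᵀ * X ≤ r ^ 2 • 1) : opNorm X ≤ r := by
  refine ContinuousLinearMap.opNorm_le_bound _ hr fun x => ?_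
  have hx := (le_iff_dotProduct (by simp) (by simp)).1 h x.ofLp
  rw [dotProduct_transpose_mul_self, ← norm_toLp_sq, Matrix.smul_mulVec, Matrix.one_mulVec,
    dotProduct_smul, smul_eq_mul, ← norm_toLp_sq, ← mul_pow] at hx
  exact (sq_le_sq₀ (norm_nonneg _) (by positivity)).1 hx

theorem le_opNorm_smul_one {H : Matrix (Fin a) (Fin a) ℝ} (hH : Hᵀ = H) : H ≤ opNorm H • 1 := by
  refine (le_iff_dotProduct hH (by simp)).2 fun v => ?_
  have hinner : inner ℝ (WithLp.toLp 2 (H *ᵥ v)) (WithLp.toLp 2 v) = v ⬝ᵥ H *ᵥ v := by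
    simp [EuclideanSpace.inner_eq_star_dotProduct]
  calc v ⬝ᵥ H *ᵥ v ≤ ‖WithLp.toLp 2 (H *ᵥ v)‖ * ‖WithLp.toLp 2 v‖ :=
        hinner ▸ real_inner_le_norm _ _
    _ ≤ opNorm H * ‖WithLp.toLp 2 v‖ * ‖WithLp.toLp 2 v‖ := by
        gcongr
        exact Matrix.l2_opNorm_mulVec H (WithLp.toLp 2 v)
    _ = v ⬝ᵥ (opNorm H • (1 : Matrix (Fin a) (Fin a) ℝ)) *ᵥ v := by
        rw [mul_assoc, ← sq, norm_toLp_sq, Matrix.smul_mulVec, Matrix.one_mulVec, dotProduct_smul,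
          smul_eq_mul]

theorem transpose_mul_self_le (X : Matrix (Fin a) (Fin b) ℝ) : Xᵀ * X ≤ opNorm X ^ 2 • 1 := by
  rw [← opNorm_transpose_mul_self]
  exact le_opNorm_smul_one (by simp)

theorem transpose_mul_self_add_le (X Z : Matrix (Fin a) (Fin b) ℝ) :
    (X + Z)ᵀ * (X + Z) ≤ Xᵀ * X + (2 * (opNorm X * opNorm Z) + opNorm Z ^ 2) • 1 := by
  have hcross : Xᵀ * Z + Zᵀ * X ≤ (2 * (opNorm X * opNorm Z)) • 1 := by
    refine (le_opNorm_smul_one (by simp [add_comm])).trans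
      (smul_le_smul_of_nonneg_right ?_ zero_le_one)
    refine (opNorm_add_le _ _).trans ?_
    have hXZ := opNorm_mul_le Xᵀ Z
    have hZX := opNorm_mul_le Zᵀ X
    rw [opNorm_transpose] at hXZ hZX
    linarith
  calc (X + Z)ᵀ * (X + Z) = Xᵀ * X + (Xᵀ * Z + Zᵀ * X) + Zᵀ * Z := by
        simp only [Matrix.transpose_add, Matrix.add_mul, Matrix.mul_add]
        abel
    _ ≤ Xᵀ * X + (2 * (opNorm X * opNorm Z)) • 1 + opNorm Z ^ 2 • 1 := by
        gcongr
        exact transpose_mul_self_le Z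
    _ = Xᵀ * X + (2 * (opNorm X * opNorm Z) + opNorm Z ^ 2) • 1 := by
        rw [add_assoc, add_smul]

theorem opNorm_mono {P Q : Matrix (Fin a) (Fin a) ℝ} (hP : 0 ≤ P) (h : P ≤ Q) :
    opNorm P ≤ opNorm Q := by
  obtain ⟨S, rfl⟩ := exists_eq_transpose_mul_self hP
  have hS := h.trans (le_opNorm_smul_one (transpose_eq_of_nonneg (hP.trans h)))
  rw [opNorm_transpose_mul_self, ← Real.le_sqrt (opNorm_nonneg _) (opNorm_nonneg _)]
  refine opNorm_le_of_transpose_mul_self_le (Real.sqrt_nonneg _) ?_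
  rwa [Real.sq_sqrt (opNorm_nonneg _)]

theorem opNorm_sq_le {X : Matrix (Fin a) (Fin b) ℝ} {Q : Matrix (Fin b) (Fin b) ℝ}
    (h : Xᵀ * X ≤ Q) : opNorm X ^ 2 ≤ opNorm Q := by
  rw [← opNorm_transpose_mul_self]
  exact opNorm_mono (transpose_mul_self_nonneg X) h

theorem opNorm_mul_le_opNorm_mul {X : Matrix (Fin a) (Fin b) ℝ} {T : Matrix (Fin c) (Fin b) ℝ}
    (h : Xᵀ * X ≤ Tᵀ * T) {d : ℕ} (Y : Matrix (Fin b) (Fin d) ℝ) :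
    opNorm (X * Y) ≤ opNorm (T * Y) := by
  refine (pow_le_pow_iff_left₀ (opNorm_nonneg _) (opNorm_nonneg _) two_ne_zero).1 ?_
  rw [← opNorm_transpose_mul_self (T * Y)]
  refine opNorm_sq_le ?_
  simpa only [Matrix.transpose_mul, Matrix.mul_assoc] using transpose_mul_mul_mono h Y

theorem one_le_opNorm [NeZero a] {P : Matrix (Fin a) (Fin a) ℝ} (h : 1 ≤ P) : 1 ≤ opNorm P := by
  have hone : opNorm (1 : Matrix (Fin a) (Fin a) ℝ) = 1 := by
    open scoped Matrix.Norms.L2Operator in exact CStarRing.norm_one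
  exact hone ▸ opNorm_mono zero_le_one h

theorem opNorm_mul_inv_le {X : Matrix (Fin a) (Fin b) ℝ} {S : Matrix (Fin b) (Fin b) ℝ} {r : ℝ}
    (hr : 0 ≤ r) (hS : IsUnit S.det) (h : Xᵀ * X ≤ r ^ 2 • (Sᵀ * S)) : opNorm (X * S⁻¹) ≤ r := by
  refine opNorm_le_of_transpose_mul_self_le hr ?_
  calc (X * S⁻¹)ᵀ * (X * S⁻¹) = S⁻¹ᵀ * (Xᵀ * X) * S⁻¹ := by
        simp only [Matrix.transpose_mul, Matrix.mul_assoc]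
    _ ≤ S⁻¹ᵀ * (r ^ 2 • (Sᵀ * S)) * S⁻¹ := transpose_mul_mul_mono h S⁻¹
    _ = r ^ 2 • ((S * S⁻¹)ᵀ * (S * S⁻¹)) := by
        simp only [Matrix.transpose_mul, Matrix.mul_assoc, Matrix.mul_smul, Matrix.smul_mul]
    _ = r ^ 2 • 1 := by rw [Matrix.mul_nonsing_inv _ hS]; simp

theorem opNorm_inv_le_one {S : Matrix (Fin a) (Fin a) ℝ} (h : 1 ≤ Sᵀ * S) : opNorm S⁻¹ ≤ 1 := by
  simpa using opNorm_mul_inv_le (X := (1 : Matrix (Fin a) (Fin a) ℝ)) zero_le_one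
    (isUnit_det_of_one_le h) (by simpa using h)

theorem frobNorm_sq (X : Matrix (Fin a) (Fin b) ℝ) : frobNorm X ^ 2 = (Xᵀ * X).trace := by
  have h : frobNorm X = √(∑ i, ∑ j, X i j ^ 2) := by
    open scoped Matrix.Norms.Frobenius in
    exact (Matrix.frobenius_norm_def X).trans (by simp [Real.sqrt_eq_rpow])
  rw [h, Real.sq_sqrt (by positivity), Finset.sum_comm]
  simp [Matrix.trace, Matrix.mul_apply, sq]

theorem frobNorm_nonneg (X : Matrix (Fin a) (Fin b) ℝ) : 0 ≤ frobNorm X := by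
  open scoped Matrix.Norms.Frobenius in exact norm_nonneg X

theorem frobNorm_transpose (X : Matrix (Fin a) (Fin b) ℝ) : frobNorm Xᵀ = frobNorm X := by
  open scoped Matrix.Norms.Frobenius in exact Matrix.frobenius_norm_transpose X

theorem frobNorm_mul_le_opNorm_mul (X : Matrix (Fin a) (Fin b) ℝ) (Y : Matrix (Fin b) (Fin c) ℝ) :
    frobNorm (X * Y) ≤ opNorm X * frobNorm Y := by
  refine (sq_le_sq₀ (frobNorm_nonneg _)
    (mul_nonneg (opNorm_nonneg _) (frobNorm_nonneg _))).1 ?_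
  calc frobNorm (X * Y) ^ 2 = (Yᵀ * (Xᵀ * X) * Y).trace := by
        rw [frobNorm_sq, Matrix.transpose_mul]
        simp only [Matrix.mul_assoc]
    _ ≤ (Yᵀ * (opNorm X ^ 2 • (1 : Matrix (Fin b) (Fin b) ℝ)) * Y).trace :=
        trace_mono (transpose_mul_mul_mono (transpose_mul_self_le X) Y)
    _ = (opNorm X * frobNorm Y) ^ 2 := by simp [mul_pow, frobNorm_sq]

theorem frobNorm_mul_le_mul_opNorm (X : Matrix (Fin a) (Fin b) ℝ) (Y : Matrix (Fin b) (Fin c) ℝ) :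
    frobNorm (X * Y) ≤ frobNorm X * opNorm Y := by
  rw [← frobNorm_transpose, Matrix.transpose_mul, ← frobNorm_transpose X, ← opNorm_transpose Y,
    mul_comm]
  exact frobNorm_mul_le_opNorm_mul _ _

/-- A family of matrix norms, such as the spectral or the Frobenius norm, for which multiplication
by a matrix `X` is bounded by the spectral norm of `X` on either side. Perturbation bounds are
proved for all such norms at once. Definiteness and homogeneity are not required. -/
structure IsOperatorIdealNorm (N : ∀ {a b : ℕ}, Matrix (Fin a) (Fin b) ℝ → ℝ) : Prop where
  nonneg : ∀ {a b : ℕ} (X : Matrix (Fin a) (Fin b) ℝ), 0 ≤ N X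
  add_le : ∀ {a b : ℕ} (X Y : Matrix (Fin a) (Fin b) ℝ), N (X + Y) ≤ N X + N Y
  transpose : ∀ {a b : ℕ} (X : Matrix (Fin a) (Fin b) ℝ), N Xᵀ = N X
  mul_le_opNorm_mul : ∀ {a b c : ℕ} (X : Matrix (Fin a) (Fin b) ℝ) (Y : Matrix (Fin b) (Fin c) ℝ),
    N (X * Y) ≤ opNorm X * N Y
  mul_le_mul_opNorm : ∀ {a b c : ℕ} (X : Matrix (Fin a) (Fin b) ℝ) (Y : Matrix (Fin b) (Fin c) ℝ),
    N (X * Y) ≤ N X * opNorm Y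

theorem isOperatorIdealNorm_opNorm : IsOperatorIdealNorm opNorm :=
  ⟨opNorm_nonneg, opNorm_add_le, opNorm_transpose, opNorm_mul_le, opNorm_mul_le⟩

theorem isOperatorIdealNorm_frobNorm : IsOperatorIdealNorm frobNorm where
  nonneg := frobNorm_nonneg
  add_le X Y := by open scoped Matrix.Norms.Frobenius in exact norm_add_le X Y
  transpose := frobNorm_transpose
  mul_le_opNorm_mul := frobNorm_mul_le_opNorm_mul
  mul_le_mul_opNorm := frobNorm_mul_le_mul_opNorm

namespace IsOperatorIdealNorm

variable {N : ∀ {a b : ℕ}, Matrix (Fin a) (Fin b) ℝ → ℝ}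

theorem mul_le (hN : IsOperatorIdealNorm N) {X : Matrix (Fin a) (Fin b) ℝ}
    {Y : Matrix (Fin b) (Fin c) ℝ} {x y : ℝ} (hX : opNorm X ≤ x) (hY : N Y ≤ y) :
    N (X * Y) ≤ x * y :=
  (hN.mul_le_opNorm_mul X Y).trans
    (mul_le_mul hX hY (hN.nonneg Y) ((opNorm_nonneg X).trans hX))

theorem mul_le' (hN : IsOperatorIdealNorm N) {X : Matrix (Fin a) (Fin b) ℝ}
    {Y : Matrix (Fin b) (Fin c) ℝ} {x y : ℝ} (hX : N X ≤ x) (hY : opNorm Y ≤ y) :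
    N (X * Y) ≤ x * y :=
  (hN.mul_le_mul_opNorm X Y).trans
    (mul_le_mul hX hY (opNorm_nonneg Y) ((hN.nonneg X).trans hX))

/-- The estimate behind the perturbation bound: the difference `D` of two Riccati solutions,
suitably normalized, satisfies such a fixed-point equation with a small `F`. -/
theorem le_mul_of_eq_add (hN : IsOperatorIdealNorm N) {D F : Matrix (Fin a) (Fin b) ℝ}
    {X : Matrix (Fin a) (Fin a) ℝ} {Y : Matrix (Fin b) (Fin b) ℝ} {q : ℝ} (hq : 0 < q)
    (hX : opNorm X ^ 2 ≤ 1 - q⁻¹) (hY : opNorm Y ^ 2 ≤ 1 - q⁻¹) (h : D = Xᵀ * D * Y + F) :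
    N D ≤ q * N F := by
  have hXY : opNorm X * opNorm Y ≤ 1 - q⁻¹ := by nlinarith [sq_nonneg (opNorm X - opNorm Y)]
  have hD : N D ≤ (1 - q⁻¹) * N D + N F := calc
    N D ≤ opNorm Xᵀ * N D * opNorm Y + N F := by
      conv_lhs => rw [h]
      exact (hN.add_le _ _).trans
        (by gcongr; exact hN.mul_le' (hN.mul_le_opNorm_mul _ _) le_rfl)
    _ = opNorm X * opNorm Y * N D + N F := by rw [opNorm_transpose]; ring
    _ ≤ (1 - q⁻¹) * N D + N F := by gcongr; exact hN.nonneg D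
  have hqD : q⁻¹ * N D ≤ N F := by linarith
  rwa [inv_mul_le_iff₀ hq] at hqD

end IsOperatorIdealNorm

end Norms

section FixedPoints

theorem iterate_zero_mem_Icc {α : Type*} [Preorder α] [Zero α] {f : α → α} {u : α}
    (hf : MonotoneOn f (Set.Ici 0)) (hf0 : 0 ≤ f 0) (hu0 : 0 ≤ u) (hu : f u ≤ u) (k : ℕ) :
    f^[k] 0 ∈ Set.Icc 0 u := by
  have hmaps : Set.MapsTo f (Set.Icc 0 u) (Set.Icc 0 u) := fun x hx =>
    ⟨hf0.trans (hf Set.self_mem_Ici hx.1 hx.1), (hf hx.1 hu0 hx.2).trans hu⟩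
  exact hmaps.iterate k (Set.left_mem_Icc.2 hu0)

theorem monotone_iterate_zero {α : Type*} [Preorder α] [Zero α] {f : α → α}
    (hf : MonotoneOn f (Set.Ici 0)) (hf0 : 0 ≤ f 0) : Monotone fun k => f^[k] 0 := by
  have hmaps : Set.MapsTo f (Set.Ici 0) (Set.Ici 0) := fun x hx =>
    hf0.trans (hf Set.self_mem_Ici hx hx)
  have hnonneg (k : ℕ) : 0 ≤ f^[k] 0 := hmaps.iterate k Set.self_mem_Ici
  refine monotone_nat_of_le_succ fun k => ?_
  induction k with
  | zero => exact hf0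
  | succ k ih =>
    simp only [Function.iterate_succ_apply' f] at ih ⊢
    exact hf (hnonneg k) (hmaps (hnonneg k)) ih

theorem exists_fixedPoint_of_map_le {n : Type*} [Finite n] {F : Matrix n n ℝ → Matrix n n ℝ}
    {U : Matrix n n ℝ} (hF : MonotoneOn F (Set.Ici 0)) (hF0 : 0 ≤ F 0)
    (hFc : ∀ P, 0 ≤ P → ContinuousAt F P) (hU0 : 0 ≤ U) (hU : F U ≤ U) :
    ∃ P, 0 ≤ P ∧ F P = P ∧ P ≤ U ∧ Tendsto (fun k => F^[k] 0) atTop (𝓝 P) := by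
  have hmem := iterate_zero_mem_Icc hF hF0 hU0 hU
  obtain ⟨P, hP⟩ := exists_tendsto_of_monotone (monotone_iterate_zero hF hF0) le_rfl
    fun k => (hmem k).2
  have hP0 : 0 ≤ P := ge_of_tendsto' hP fun k => (hmem k).1
  exact ⟨P, hP0, isFixedPt_of_tendsto_iterate hP (hFc P hP0),
    le_of_tendsto' hP fun k => (hmem k).2, hP⟩

end FixedPoints

section Stability

variable {a : ℕ} {X X' : Matrix (Fin a) (Fin a) ℝ}

theorem spectralRadius_lt_one_iff_tendsto_pow {R : Type*} [NormedRing R] [NormedAlgebra ℂ R]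
    [CompleteSpace R] (x : R) :
    spectralRadius ℂ x < 1 ↔ Tendsto (fun n => x ^ n) atTop (𝓝 0) := by
  constructor
  · intro h
    obtain ⟨c, hxc, hc⟩ := exists_between h
    suffices hnorm : Tendsto (fun n => (‖x ^ n‖₊ : ENNReal)) atTop (𝓝 ((0 : NNReal) : ENNReal)) from
      tendsto_zero_iff_norm_tendsto_zero.2 (NNReal.tendsto_coe.2 (ENNReal.tendsto_coe.1 hnorm))
    refine tendsto_of_tendsto_of_tendsto_of_le_of_le' tendsto_const_nhds
      (ENNReal.tendsto_pow_atTop_nhds_zero_of_lt_one hc) (Eventually.of_forall fun _ => zero_le) ?_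
    -- Gelfand's formula: `‖xⁿ‖` is eventually below `cⁿ`.
    filter_upwards [(spectrum.pow_nnnorm_pow_one_div_tendsto_nhds_spectralRadius
      x).eventually_lt_const hxc, eventually_gt_atTop 0] with n hn hn0
    rw [one_div, ENNReal.rpow_inv_lt_iff (by positivity), ENNReal.rpow_natCast] at hn
    exact hn.le
  · intro h
    have hlim : Tendsto (fun n => ‖x ^ (n + 1)‖₊ * ‖(1 : R)‖₊) atTop (𝓝 0) := by
      simpa using (((tendsto_add_atTop_iff_nat 1).2 h).nnnorm).mul_const ‖(1 : R)‖₊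
    obtain ⟨n, hn⟩ := (hlim.eventually_lt_const one_pos).exists
    refine (spectrum.spectralRadius_le_pow_nnnorm_pow_one_div ℂ x n).trans_lt ?_
    rw [← ENNReal.mul_rpow_of_nonneg _ _ (by positivity)]
    exact ENNReal.rpow_lt_one (by exact_mod_cast hn) (by positivity)

theorem isStable_iff_tendsto_pow : IsStable X ↔ Tendsto (fun n => X ^ n) atTop (𝓝 0) := by
  have hpow (n : ℕ) : X.map Complex.ofReal ^ n = (X ^ n).map Complex.ofReal :=
    (map_pow Complex.ofRealHom.mapMatrix X n).symm
  have hofReal : Continuous fun M : Matrix (Fin a) (Fin a) ℝ => M.map Complex.ofReal :=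
    continuous_id.matrix_map Complex.continuous_ofReal
  have hre : Continuous fun M : Matrix (Fin a) (Fin a) ℂ => M.map Complex.re :=
    continuous_id.matrix_map Complex.continuous_re
  open scoped Matrix.Norms.L2Operator in
  refine (spectralRadius_lt_one_iff_tendsto_pow (X.map Complex.ofReal)).trans ?_
  simp_rw [hpow]
  constructor <;> intro h
  · have hlim := (hre.tendsto 0).comp h
    rw [Matrix.map_zero _ Complex.zero_re] at hlim
    refine hlim.congr fun n => ?_
    ext i j
    exact Complex.ofReal_re _
  · have hlim := (hofReal.tendsto 0).comp h
    rwa [Matrix.map_zero _ Complex.ofReal_zero] at hlim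

theorem eq_zero_of_eq_transpose_mul_mul (hX : IsStable X) (hX' : IsStable X')
    {D : Matrix (Fin a) (Fin a) ℝ} (h : D = Xᵀ * D * X') : D = 0 := by
  have hpow (n : ℕ) : D = (X ^ n)ᵀ * D * X' ^ n := by
    induction n with
    | zero => simp
    | succ n ih =>
      calc D = (X ^ n)ᵀ * (Xᵀ * D * X') * X' ^ n := by rw [← h]; exact ih
        _ = (X ^ (n + 1))ᵀ * D * X' ^ (n + 1) := by
          simp only [pow_succ', Matrix.transpose_mul, Matrix.mul_assoc]
  have hlim : Tendsto (fun n => (X ^ n)ᵀ * D * X' ^ n) atTop (𝓝 ((0 : Matrix _ _ ℝ)ᵀ * D * 0)) :=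
    ((continuous_id.matrix_transpose.tendsto _).comp (isStable_iff_tendsto_pow.1 hX)
      |>.mul_const D).mul (isStable_iff_tendsto_pow.1 hX')
  simpa using tendsto_nhds_unique (tendsto_const_nhds.congr hpow) hlim

end Stability

section Lyapunov

variable {a : ℕ} {X Y P Q U : Matrix (Fin a) (Fin a) ℝ}

/-- The affine map whose fixed points solve the discrete Lyapunov equation. -/
def lyapunovMap (X Y P : Matrix (Fin a) (Fin a) ℝ) : Matrix (Fin a) (Fin a) ℝ :=
  Xᵀ * P * X + Y

theorem lyapunovMap_mono (X Y : Matrix (Fin a) (Fin a) ℝ) : Monotone (lyapunovMap X Y) :=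
  fun _ _ h => add_le_add_left (transpose_mul_mul_mono h X) Y

theorem le_lyapunovMap (X Y : Matrix (Fin a) (Fin a) ℝ) (hP : 0 ≤ P) : Y ≤ lyapunovMap X Y P :=
  le_add_of_nonneg_left (transpose_mul_mul_nonneg hP X)

theorem iterate_lyapunovMap_zero (X Y : Matrix (Fin a) (Fin a) ℝ) (n : ℕ) :
    (lyapunovMap X Y)^[n] 0 = ∑ j ∈ Finset.range n, (X ^ j)ᵀ * Y * X ^ j := by
  induction n with
  | zero => rfl
  | succ n ih =>
    rw [Function.iterate_succ_apply', ih, lyapunovMap, Finset.sum_range_succ', Finset.mul_sum,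
      Finset.sum_mul]
    simp [pow_succ, Matrix.transpose_mul, Matrix.mul_assoc]

theorem isLyapunovSolution_iff :
    IsLyapunovSolution X Y P ↔ 0 ≤ P ∧ lyapunovMap X Y P = P := by
  rw [IsLyapunovSolution, Matrix.nonneg_iff_posSemidef, lyapunovMap, eq_comm (a := P)]

theorem exists_isLyapunovSolution_of_le (hY : 0 ≤ Y) (hU0 : 0 ≤ U) (hU : lyapunovMap X Y U ≤ U) :
    ∃ P, IsLyapunovSolution X Y P ∧ P ≤ U ∧
      Tendsto (fun k => (lyapunovMap X Y)^[k] 0) atTop (𝓝 P) := by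
  have hcont : Continuous (lyapunovMap X Y) := by unfold lyapunovMap; fun_prop
  obtain ⟨P, hP0, hP, hPU, hlim⟩ := exists_fixedPoint_of_map_le
    ((lyapunovMap_mono X Y).monotoneOn _) (hY.trans (le_lyapunovMap X Y le_rfl))
    (fun _ _ => hcont.continuousAt) hU0 hU
  exact ⟨P, isLyapunovSolution_iff.2 ⟨hP0, hP⟩, hPU, hlim⟩

/-- The squared Frobenius norms of the powers of `X` sum up to at most the trace of `U`. -/
theorem isStable_of_lyapunovMap_le (hU0 : 0 ≤ U) (hY : 1 ≤ Y) (hU : lyapunovMap X Y U ≤ U) :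
    IsStable X := by
  have hU1 : lyapunovMap X 1 U ≤ U := (add_le_add_right hY _).trans hU
  have hsum (n : ℕ) : ∑ j ∈ Finset.range n, frobNorm (X ^ j) ^ 2 ≤ U.trace := by
    have hle := (iterate_zero_mem_Icc ((lyapunovMap_mono X 1).monotoneOn _)
      (zero_le_one.trans (le_lyapunovMap X 1 le_rfl)) hU0 hU1 n).2
    simpa [iterate_lyapunovMap_zero, Matrix.trace_sum, frobNorm_sq] using trace_mono hle
  have hsq : Tendsto (fun n => frobNorm (X ^ n) ^ 2) atTop (𝓝 0) :=
    (summable_of_sum_range_le (fun _ => sq_nonneg _) hsum).tendsto_atTop_zero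
  have hfrob : Tendsto (fun n => frobNorm (X ^ n)) atTop (𝓝 0) := by
    simpa [Real.sqrt_sq (frobNorm_nonneg _)] using hsq.sqrt
  rw [isStable_iff_tendsto_pow]
  open scoped Matrix.Norms.Frobenius in exact tendsto_zero_iff_norm_tendsto_zero.2 hfrob

theorem lyapunovMap_one_sum_pow (X : Matrix (Fin a) (Fin a) ℝ) (n : ℕ) :
    lyapunovMap X 1 (∑ j ∈ Finset.range n, (X ^ j)ᵀ * X ^ j) =
      ∑ j ∈ Finset.range n, (X ^ j)ᵀ * X ^ j + (X ^ n)ᵀ * X ^ n := by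
  have h := iterate_lyapunovMap_zero X 1
  simp only [mul_one] at h
  rw [← Finset.sum_range_succ, ← h, ← h, Function.iterate_succ_apply']

/-- If `‖Xⁿ‖ < 1`, then a multiple of the `n`-th partial sum of `∑ (Xʲ)ᵀ Xʲ` will do. -/
theorem IsStable.exists_lyapunovMap_le (hX : IsStable X) (hY : 0 ≤ Y) :
    ∃ U, 0 ≤ U ∧ lyapunovMap X Y U ≤ U := by
  have hnorm : Tendsto (fun n => opNorm (X ^ n)) atTop (𝓝 0) := by
    open scoped Matrix.Norms.L2Operator in
    exact tendsto_zero_iff_norm_tendsto_zero.1 (isStable_iff_tendsto_pow.1 hX)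
  obtain ⟨n, hn⟩ := (hnorm.eventually_lt_const one_pos).exists
  set c := opNorm (X ^ n) ^ 2
  have hc1 : 0 < 1 - c := sub_pos.2 ((sq_lt_one_iff₀ (opNorm_nonneg _)).2 hn)
  set W := ∑ j ∈ Finset.range n, (X ^ j)ᵀ * X ^ j
  have hW0 : 0 ≤ W := Finset.sum_nonneg fun j _ => transpose_mul_self_nonneg _
  have hW : Xᵀ * W * X + (1 - c) • 1 ≤ W := by
    have hle : lyapunovMap X 1 W ≤ W + c • 1 :=
      (lyapunovMap_one_sum_pow X n).trans_le (add_le_add_right (transpose_mul_self_le _) _)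
    rw [sub_smul, one_smul, ← add_sub_assoc]
    exact sub_le_iff_le_add.2 hle
  set r := opNorm Y / (1 - c)
  have hr : 0 ≤ r := div_nonneg (opNorm_nonneg _) hc1.le
  refine ⟨r • W, smul_nonneg hr hW0, ?_⟩
  calc lyapunovMap X Y (r • W) ≤ Xᵀ * (r • W) * X + opNorm Y • 1 :=
        add_le_add_right (le_opNorm_smul_one (transpose_eq_of_nonneg hY)) _
    _ = r • (Xᵀ * W * X + (1 - c) • 1) := by
        rw [Matrix.mul_smul, Matrix.smul_mul, smul_add, smul_smul, div_mul_cancel₀ _ hc1.ne']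
    _ ≤ r • W := smul_le_smul_of_nonneg_left hW hr

theorem IsLyapunovSolution.nonneg (h : IsLyapunovSolution X Y P) : 0 ≤ P := h.1.nonneg

theorem IsLyapunovSolution.le (h : IsLyapunovSolution X Y P) : Y ≤ P :=
  (le_lyapunovMap X Y h.nonneg).trans_eq (isLyapunovSolution_iff.1 h).2

theorem IsLyapunovSolution.isStable (h : IsLyapunovSolution X Y P) (hY : 1 ≤ Y) : IsStable X :=
  isStable_of_lyapunovMap_le h.nonneg hY (isLyapunovSolution_iff.1 h).2.le

theorem IsLyapunovSolution.eq (h : IsLyapunovSolution X Y P) (h' : IsLyapunovSolution X Y Q)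
    (hX : IsStable X) : P = Q := by
  refine sub_eq_zero.1 (eq_zero_of_eq_transpose_mul_mul hX hX ?_)
  nth_rw 1 [h.2, h'.2]
  rw [add_sub_add_right_eq_sub, Matrix.mul_sub, Matrix.sub_mul]

theorem IsLyapunovSolution.tendsto_iterate (h : IsLyapunovSolution X Y P) (hY : 1 ≤ Y) :
    Tendsto (fun k => (lyapunovMap X Y)^[k] 0) atTop (𝓝 P) := by
  obtain ⟨Q, hQ, -, hlim⟩ := exists_isLyapunovSolution_of_le (zero_le_one.trans hY) h.nonneg
    (isLyapunovSolution_iff.1 h).2.le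
  rwa [h.eq hQ (h.isStable hY)]

theorem isLyapunovSolution_dlyap (h : ∃ P, IsLyapunovSolution X Y P) :
    IsLyapunovSolution X Y (dlyap X Y) :=
  Classical.epsilon_spec h

end Lyapunov

section Riccati

variable {dx du : ℕ} {Rx A P Q U : Matrix (Fin dx) (Fin dx) ℝ} {Ru : Matrix (Fin du) (Fin du) ℝ}
  {B : Matrix (Fin dx) (Fin du) ℝ} {K : Matrix (Fin du) (Fin dx) ℝ}

/-- The Riccati operator: one step of value iteration. -/
noncomputable def riccatiMap (Rx : Matrix (Fin dx) (Fin dx) ℝ) (Ru : Matrix (Fin du) (Fin du) ℝ)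
    (A : Matrix (Fin dx) (Fin dx) ℝ) (B : Matrix (Fin dx) (Fin du) ℝ)
    (P : Matrix (Fin dx) (Fin dx) ℝ) : Matrix (Fin dx) (Fin dx) ℝ :=
  Aᵀ * P * A - Aᵀ * P * B * (Ru + Bᵀ * P * B)⁻¹ * Bᵀ * P * A + Rx

/-- The greedy controller for the value matrix `P`, so that `Kinf` is the gain of `Pinf`. -/
noncomputable def gain (Ru : Matrix (Fin du) (Fin du) ℝ) (A : Matrix (Fin dx) (Fin dx) ℝ)
    (B : Matrix (Fin dx) (Fin du) ℝ) (P : Matrix (Fin dx) (Fin dx) ℝ) :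
    Matrix (Fin du) (Fin dx) ℝ :=
  -((Ru + Bᵀ * P * B)⁻¹ * Bᵀ * P * A)

/-- The dynamics of `(A, B)` under the greedy controller for the value matrix `P`. -/
noncomputable def closedLoop (Ru : Matrix (Fin du) (Fin du) ℝ) (A : Matrix (Fin dx) (Fin dx) ℝ)
    (B : Matrix (Fin dx) (Fin du) ℝ) (P : Matrix (Fin dx) (Fin dx) ℝ) :
    Matrix (Fin dx) (Fin dx) ℝ :=
  A + B * gain Ru A B P

/-- The Bellman operator of a fixed controller `K`: one step of policy evaluation. -/
def policyMap (Rx : Matrix (Fin dx) (Fin dx) ℝ) (Ru : Matrix (Fin du) (Fin du) ℝ)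
    (A : Matrix (Fin dx) (Fin dx) ℝ) (B : Matrix (Fin dx) (Fin du) ℝ)
    (K : Matrix (Fin du) (Fin dx) ℝ) : Matrix (Fin dx) (Fin dx) ℝ → Matrix (Fin dx) (Fin dx) ℝ :=
  lyapunovMap (A + B * K) (Rx + Kᵀ * Ru * K)

theorem one_le_policyCost (hRx : 1 ≤ Rx) (hRu : 0 ≤ Ru) (K : Matrix (Fin du) (Fin dx) ℝ) :
    1 ≤ Rx + Kᵀ * Ru * K :=
  hRx.trans (le_add_of_nonneg_right (transpose_mul_mul_nonneg hRu K))

theorem posDef_inputCost (hRu : Ru.PosDef) (hP : 0 ≤ P) (B : Matrix (Fin dx) (Fin du) ℝ) :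
    (Ru + Bᵀ * P * B).PosDef :=
  hRu.add_posSemidef (Matrix.nonneg_iff_posSemidef.1 (transpose_mul_mul_nonneg hP B))

theorem isUnit_det_inputCost (hRu : Ru.PosDef) (hP : 0 ≤ P) (B : Matrix (Fin dx) (Fin du) ℝ) :
    IsUnit (Ru + Bᵀ * P * B).det :=
  (Matrix.isUnit_iff_isUnit_det _).1 (posDef_inputCost hRu hP B).isUnit

theorem one_le_inputCost (hRu : 1 ≤ Ru) (hP : 0 ≤ P) (B : Matrix (Fin dx) (Fin du) ℝ) :
    1 ≤ Ru + Bᵀ * P * B :=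
  hRu.trans (le_add_of_nonneg_right (transpose_mul_mul_nonneg hP B))

theorem transpose_mul_self_le_inputCost (hRu : 0 ≤ Ru) (hP : 1 ≤ P)
    (B : Matrix (Fin dx) (Fin du) ℝ) : Bᵀ * B ≤ Ru + Bᵀ * P * B := calc
  Bᵀ * B ≤ Bᵀ * P * B := by simpa using transpose_mul_mul_mono hP B
  _ ≤ Ru + Bᵀ * P * B := le_add_of_nonneg_left hRu

theorem inputCost_mul_sub_gain (hRu : Ru.PosDef) (hP : 0 ≤ P) (A : Matrix (Fin dx) (Fin dx) ℝ)
    (B : Matrix (Fin dx) (Fin du) ℝ) (K : Matrix (Fin du) (Fin dx) ℝ) :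
    (Ru + Bᵀ * P * B) * (K - gain Ru A B P) = Ru * K + Bᵀ * P * (A + B * K) := by
  rw [Matrix.mul_sub, gain, Matrix.mul_neg, Matrix.mul_assoc _ Bᵀ, Matrix.mul_assoc _ (Bᵀ * P),
    Matrix.mul_nonsing_inv_cancel_left _ _ (isUnit_det_inputCost hRu hP B), sub_neg_eq_add,
    Matrix.add_mul, Matrix.mul_add, Matrix.mul_assoc _ B, add_assoc, add_comm (Bᵀ * P * A)]

theorem mul_gain_eq_neg (hRu : Ru.PosDef) (hP : 0 ≤ P) (A : Matrix (Fin dx) (Fin dx) ℝ)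
    (B : Matrix (Fin dx) (Fin du) ℝ) :
    Ru * gain Ru A B P = -(Bᵀ * P * closedLoop Ru A B P) := by
  have h := inputCost_mul_sub_gain hRu hP A B (gain Ru A B P)
  rw [sub_self, Matrix.mul_zero] at h
  exact eq_neg_of_add_eq_zero_left h.symm

theorem riccatiMap_eq (Rx : Matrix (Fin dx) (Fin dx) ℝ) (Ru : Matrix (Fin du) (Fin du) ℝ)
    (A : Matrix (Fin dx) (Fin dx) ℝ) (B : Matrix (Fin dx) (Fin du) ℝ)
    (P : Matrix (Fin dx) (Fin dx) ℝ) :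
    riccatiMap Rx Ru A B P = Aᵀ * P * closedLoop Ru A B P + Rx := by
  simp only [riccatiMap, closedLoop, gain, Matrix.mul_neg, Matrix.mul_add, Matrix.mul_assoc,
    sub_eq_add_neg]

theorem policyMap_eq_riccatiMap_add (hRu : Ru.PosDef) (hP : 0 ≤ P)
    (Rx A : Matrix (Fin dx) (Fin dx) ℝ) (B : Matrix (Fin dx) (Fin du) ℝ)
    (K : Matrix (Fin du) (Fin dx) ℝ) :
    policyMap Rx Ru A B K P = riccatiMap Rx Ru A B P +
      (K - gain Ru A B P)ᵀ * (Ru + Bᵀ * P * B) * (K - gain Ru A B P) := by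
  have hgain : (gain Ru A B P)ᵀ * (Ru + Bᵀ * P * B) = -(Aᵀ * P * B) := by
    have h := congrArg Matrix.transpose (inputCost_mul_sub_gain hRu hP A B 0)
    simp only [Matrix.transpose_mul, Matrix.transpose_add, Matrix.transpose_neg,
      Matrix.transpose_transpose, transpose_eq_of_nonneg hP, Matrix.mul_zero, add_zero, zero_sub,
      transpose_eq_of_nonneg hRu.posSemidef.nonneg, zero_add, Matrix.mul_assoc,
      Matrix.neg_mul] at h ⊢
    exact neg_eq_iff_eq_neg.1 h
  calc policyMap Rx Ru A B K P
      = Aᵀ * P * (A + B * K) + Rx + Kᵀ * (Ru * K + Bᵀ * P * (A + B * K)) := by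
        simp only [policyMap, lyapunovMap, Matrix.transpose_add, Matrix.transpose_mul,
          Matrix.mul_add, Matrix.add_mul, Matrix.mul_assoc]
        abel
    _ = Aᵀ * P * (A + B * K) + Rx + Kᵀ * ((Ru + Bᵀ * P * B) * (K - gain Ru A B P)) := by
        rw [inputCost_mul_sub_gain hRu hP]
    _ = Aᵀ * P * closedLoop Ru A B P + Rx
          + (K - gain Ru A B P)ᵀ * (Ru + Bᵀ * P * B) * (K - gain Ru A B P) := by
        rw [Matrix.transpose_sub, Matrix.sub_mul Kᵀ, hgain, closedLoop]
        simp only [Matrix.mul_sub, Matrix.sub_mul, Matrix.neg_mul, Matrix.mul_add,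
          Matrix.add_mul, Matrix.mul_assoc]
        abel
    _ = _ := by rw [riccatiMap_eq]

theorem riccatiMap_le_policyMap (hRu : Ru.PosDef) (hP : 0 ≤ P)
    (Rx A : Matrix (Fin dx) (Fin dx) ℝ) (B : Matrix (Fin dx) (Fin du) ℝ)
    (K : Matrix (Fin du) (Fin dx) ℝ) : riccatiMap Rx Ru A B P ≤ policyMap Rx Ru A B K P := by
  rw [policyMap_eq_riccatiMap_add hRu hP]
  exact le_add_of_nonneg_right
    (transpose_mul_mul_nonneg (posDef_inputCost hRu hP B).posSemidef.nonneg _)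

theorem policyMap_gain (hRu : Ru.PosDef) (hP : 0 ≤ P) (Rx A : Matrix (Fin dx) (Fin dx) ℝ)
    (B : Matrix (Fin dx) (Fin du) ℝ) :
    policyMap Rx Ru A B (gain Ru A B P) P = riccatiMap Rx Ru A B P := by
  simp [policyMap_eq_riccatiMap_add hRu hP]

theorem riccatiMap_monotoneOn (hRu : Ru.PosDef) (Rx A : Matrix (Fin dx) (Fin dx) ℝ)
    (B : Matrix (Fin dx) (Fin du) ℝ) : MonotoneOn (riccatiMap Rx Ru A B) (Set.Ici 0) := by
  intro P hP Q hQ hPQ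
  calc riccatiMap Rx Ru A B P ≤ policyMap Rx Ru A B (gain Ru A B Q) P :=
        riccatiMap_le_policyMap hRu hP ..
    _ ≤ policyMap Rx Ru A B (gain Ru A B Q) Q := lyapunovMap_mono _ _ hPQ
    _ = riccatiMap Rx Ru A B Q := policyMap_gain hRu hQ ..

theorem continuousAt_riccatiMap (hRu : Ru.PosDef) (hP : 0 ≤ P)
    (Rx A : Matrix (Fin dx) (Fin dx) ℝ) (B : Matrix (Fin dx) (Fin du) ℝ) :
    ContinuousAt (riccatiMap Rx Ru A B) P := by
  have hsum : Continuous fun P : Matrix (Fin dx) (Fin dx) ℝ => Ru + Bᵀ * P * B := by fun_prop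
  have hinv : ContinuousAt (fun P : Matrix (Fin dx) (Fin dx) ℝ => (Ru + Bᵀ * P * B)⁻¹) P := by
    have hunit := isUnit_det_inputCost hRu hP B
    simp_rw [Matrix.inv_def, Ring.inverse_eq_inv']
    exact (hsum.matrix_det.continuousAt.inv₀ hunit.ne_zero).smul hsum.matrix_adjugate.continuousAt
  have hprod : Continuous fun p : Matrix (Fin dx) (Fin dx) ℝ × Matrix (Fin du) (Fin du) ℝ =>
      Aᵀ * p.1 * A - Aᵀ * p.1 * B * p.2 * Bᵀ * p.1 * A + Rx := by fun_prop
  exact ContinuousAt.comp' (f := fun P => (P, (Ru + Bᵀ * P * B)⁻¹))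
    (g := fun p => Aᵀ * p.1 * A - Aᵀ * p.1 * B * p.2 * Bᵀ * p.1 * A + Rx)
    hprod.continuousAt (continuousAt_id.prodMk hinv)

theorem isDARESolution_iff :
    IsDARESolution Rx Ru A B P ↔ 0 ≤ P ∧ riccatiMap Rx Ru A B P = P := by
  rw [IsDARESolution, Matrix.nonneg_iff_posSemidef, riccatiMap, eq_comm (a := P)]

theorem exists_isDARESolution_of_le (hRx : 0 ≤ Rx) (hRu : Ru.PosDef) (hU0 : 0 ≤ U)
    (hU : policyMap Rx Ru A B K U ≤ U) :
    ∃ P, IsDARESolution Rx Ru A B P ∧ P ≤ U ∧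
      Tendsto (fun k => (riccatiMap Rx Ru A B)^[k] 0) atTop (𝓝 P) := by
  obtain ⟨P, hP0, hP, hPU, hlim⟩ := exists_fixedPoint_of_map_le
    (riccatiMap_monotoneOn hRu Rx A B) (hRx.trans_eq (by simp [riccatiMap]))
    (fun P hP => continuousAt_riccatiMap hRu hP Rx A B) hU0
    ((riccatiMap_le_policyMap hRu hU0 ..).trans hU)
  exact ⟨P, isDARESolution_iff.2 ⟨hP0, hP⟩, hPU, hlim⟩

theorem iterate_riccatiMap_le (hRx : 0 ≤ Rx) (hRu : Ru.PosDef) (A : Matrix (Fin dx) (Fin dx) ℝ)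
    (B : Matrix (Fin dx) (Fin du) ℝ) (K : Matrix (Fin du) (Fin dx) ℝ) (k : ℕ) :
    (riccatiMap Rx Ru A B)^[k] 0 ≤ (policyMap Rx Ru A B K)^[k] 0 := by
  have hmono := riccatiMap_monotoneOn hRu Rx A B
  have hnonneg : ∀ k, 0 ≤ (riccatiMap Rx Ru A B)^[k] 0 :=
    fun k => monotone_iterate_zero hmono (hRx.trans_eq (by simp [riccatiMap])) (Nat.zero_le k)
  induction k with
  | zero => exact le_rfl
  | succ k ih =>
    rw [Function.iterate_succ_apply', Function.iterate_succ_apply']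
    exact (riccatiMap_le_policyMap hRu (hnonneg k) ..).trans (lyapunovMap_mono _ _ ih)

end Riccati

section RiccatiSolution

variable {dx du : ℕ} {Rx A A' P P' : Matrix (Fin dx) (Fin dx) ℝ}
  {Ru : Matrix (Fin du) (Fin du) ℝ} {B B' : Matrix (Fin dx) (Fin du) ℝ}

theorem IsDARESolution.nonneg (h : IsDARESolution Rx Ru A B P) : 0 ≤ P := h.1.nonneg

theorem IsDARESolution.isLyapunovSolution (h : IsDARESolution Rx Ru A B P) (hRu : Ru.PosDef) :
    IsLyapunovSolution (closedLoop Ru A B P) (Rx + (gain Ru A B P)ᵀ * Ru * gain Ru A B P) P :=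
  isLyapunovSolution_iff.2
    ⟨h.nonneg, (policyMap_gain hRu h.nonneg Rx A B).trans (isDARESolution_iff.1 h).2⟩

theorem IsDARESolution.isStable (h : IsDARESolution Rx Ru A B P) (hRx : 1 ≤ Rx)
    (hRu : Ru.PosDef) : IsStable (closedLoop Ru A B P) :=
  (h.isLyapunovSolution hRu).isStable (one_le_policyCost hRx hRu.posSemidef.nonneg _)

theorem IsDARESolution.le (h : IsDARESolution Rx Ru A B P) (hRu : Ru.PosDef) : Rx ≤ P :=
  (le_add_of_nonneg_right (transpose_mul_mul_nonneg hRu.posSemidef.nonneg _)).trans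
    (h.isLyapunovSolution hRu).le

/-- The symmetric role of two controllers in this form of the Riccati equation makes both
perturbation identities below a subtraction of two instances. -/
theorem IsDARESolution.eq_bilinear (h : IsDARESolution Rx Ru A B P) (hRu : Ru.PosDef)
    (K : Matrix (Fin du) (Fin dx) ℝ) :
    P = (A + B * K)ᵀ * P * closedLoop Ru A B P + Rx + Kᵀ * Ru * gain Ru A B P := by
  have hgain := mul_gain_eq_neg hRu h.nonneg A B
  calc P = Aᵀ * P * closedLoop Ru A B P + Rx :=
        (isDARESolution_iff.1 h).2.symm.trans (riccatiMap_eq ..)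
    _ = _ := by
        rw [Matrix.mul_assoc Kᵀ, hgain]
        simp only [Matrix.transpose_add, Matrix.transpose_mul, Matrix.add_mul, Matrix.mul_neg,
          Matrix.mul_assoc]
        abel

theorem IsDARESolution.sub_eq (h : IsDARESolution Rx Ru A B P)
    (h' : IsDARESolution Rx Ru A' B' P') (hRx : 0 ≤ Rx) (hRu : Ru.PosDef) :
    P' - P = (closedLoop Ru A B P)ᵀ * (P' - P) * closedLoop Ru A' B' P'
      + ((A' - A + (B' - B) * gain Ru A B P)ᵀ * P' * closedLoop Ru A' B' P'
        + (closedLoop Ru A B P)ᵀ * P * (A' - A + (B' - B) * gain Ru A' B' P')) := by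
  have hP' := h'.eq_bilinear hRu (gain Ru A B P)
  have hP := congrArg Matrix.transpose (h.eq_bilinear hRu (gain Ru A' B' P'))
  have hE : A' + B' * gain Ru A B P =
      closedLoop Ru A B P + (A' - A + (B' - B) * gain Ru A B P) := by
    rw [closedLoop, Matrix.sub_mul]; abel
  have hE' : A + B * gain Ru A' B' P' =
      closedLoop Ru A' B' P' - (A' - A + (B' - B) * gain Ru A' B' P') := by
    rw [closedLoop, Matrix.sub_mul]; abel
  rw [hE] at hP'
  rw [hE'] at hP
  simp only [Matrix.transpose_add, Matrix.transpose_mul, Matrix.transpose_transpose,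
    transpose_eq_of_nonneg h.nonneg, transpose_eq_of_nonneg hRx,
    transpose_eq_of_nonneg hRu.posSemidef.nonneg] at hP
  refine (congrArg₂ (· - ·) hP' hP).trans ?_
  simp only [Matrix.transpose_add, Matrix.add_mul, Matrix.sub_mul, Matrix.mul_sub,
    Matrix.mul_assoc]
  abel

theorem IsDARESolution.inputCost_mul_gain_sub (h : IsDARESolution Rx Ru A B P)
    (h' : IsDARESolution Rx Ru A' B' P') (hRu : Ru.PosDef) :
    (Ru + Bᵀ * P * B) * (gain Ru A B P - gain Ru A' B' P') =
      (B' - B)ᵀ * P' * closedLoop Ru A' B' P' + Bᵀ * (P' - P) * closedLoop Ru A' B' P'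
        + Bᵀ * P * (A' - A + (B' - B) * gain Ru A' B' P') := by
  rw [← neg_sub, Matrix.mul_neg, inputCost_mul_sub_gain hRu h.nonneg,
    mul_gain_eq_neg hRu h'.nonneg]
  simp only [closedLoop, Matrix.transpose_sub, Matrix.sub_mul, Matrix.mul_add, Matrix.mul_sub,
    Matrix.mul_assoc]
  abel

theorem IsDARESolution.eq (h : IsDARESolution Rx Ru A B P) (h' : IsDARESolution Rx Ru A B P')
    (hRx : 1 ≤ Rx) (hRu : Ru.PosDef) : P = P' := by
  refine (sub_eq_zero.1 (eq_zero_of_eq_transpose_mul_mul (h.isStable hRx hRu)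
    (h'.isStable hRx hRu) ?_)).symm
  simpa using h.sub_eq h' (zero_le_one.trans hRx) hRu

theorem Stabilizable.exists_isDARESolution (h : Stabilizable A B) (hRx : 0 ≤ Rx)
    (hRu : Ru.PosDef) : ∃ P, IsDARESolution Rx Ru A B P := by
  obtain ⟨K, hK⟩ := h
  obtain ⟨U, hU0, hU⟩ := hK.exists_lyapunovMap_le
    (add_nonneg hRx (transpose_mul_mul_nonneg hRu.posSemidef.nonneg K))
  obtain ⟨P, hP, -⟩ := exists_isDARESolution_of_le hRx hRu hU0 hU
  exact ⟨P, hP⟩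

theorem isDARESolution_Pinf (h : ∃ P, IsDARESolution Rx Ru A B P) :
    IsDARESolution Rx Ru A B (Pinf Rx Ru A B) :=
  Classical.epsilon_spec h

theorem IsDARESolution.stabilizable (h : IsDARESolution Rx Ru A B P) (hRx : 1 ≤ Rx)
    (hRu : Ru.PosDef) : Stabilizable A B :=
  ⟨gain Ru A B P, h.isStable hRx hRu⟩

theorem IsDARESolution.tendsto_iterate (h : IsDARESolution Rx Ru A B P) (hRx : 1 ≤ Rx)
    (hRu : Ru.PosDef) : Tendsto (fun k => (riccatiMap Rx Ru A B)^[k] 0) atTop (𝓝 P) := by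
  obtain ⟨Q, hQ, -, hlim⟩ := exists_isDARESolution_of_le (zero_le_one.trans hRx) hRu h.nonneg
    (isLyapunovSolution_iff.1 (h.isLyapunovSolution hRu)).2.le
  rwa [h.eq hQ hRx hRu]

end RiccatiSolution

section SecondMoments

variable {Ω l m n : Type*} [MeasurableSpace Ω] {μ : Measure Ω} {f h : Ω → m → ℝ} {g : Ω → n → ℝ}

/-- The matrix `E[f gᵀ]` of uncentered mixed second moments of two random vectors. -/
noncomputable def crossMoment (μ : Measure Ω) (f : Ω → m → ℝ) (g : Ω → n → ℝ) : Matrix m n ℝ :=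
  Matrix.of fun i j => ∫ ω, f ω i * g ω j ∂μ

theorem crossMoment_transpose (μ : Measure Ω) (f : Ω → m → ℝ) (g : Ω → n → ℝ) :
    (crossMoment μ f g)ᵀ = crossMoment μ g f := by
  ext i j
  simp only [crossMoment, Matrix.transpose_apply, Matrix.of_apply, mul_comm]

theorem memLp_mulVec_add [Fintype m] {h : Ω → l → ℝ} {p : ENNReal} (L : Matrix l m ℝ)
    (hf : ∀ i, MemLp (fun ω => f ω i) p μ) (hh : ∀ i, MemLp (fun ω => h ω i) p μ) (i : l) :
    MemLp (fun ω => (L *ᵥ f ω + h ω) i) p μ := by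
  simp only [Matrix.mulVec, dotProduct, Pi.add_apply]
  exact (memLp_finsetSum _ fun k _ => (hf k).const_mul _).add (hh i)

theorem crossMoment_mulVec_add [Fintype m] {h : Ω → l → ℝ} (L : Matrix l m ℝ)
    (hf : ∀ i, MemLp (fun ω => f ω i) 2 μ) (hh : ∀ i, MemLp (fun ω => h ω i) 2 μ)
    (hg : ∀ j, MemLp (fun ω => g ω j) 2 μ) :
    crossMoment μ (fun ω => L *ᵥ f ω + h ω) g = L * crossMoment μ f g + crossMoment μ h g := by
  ext i j
  have hint (k : m) : Integrable (fun ω => L i k * (f ω k * g ω j)) μ :=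
    ((hf k).integrable_mul (hg j)).const_mul _
  have hint' : Integrable (fun ω => h ω i * g ω j) μ := (hh i).integrable_mul (hg j)
  calc ∫ ω, (L *ᵥ f ω + h ω) i * g ω j ∂μ
      = ∫ ω, (∑ k, L i k * (f ω k * g ω j)) + h ω i * g ω j ∂μ := by
        simp only [Matrix.mulVec, dotProduct, Pi.add_apply, add_mul, Finset.sum_mul, mul_assoc]
    _ = ∑ k, L i k * ∫ ω, f ω k * g ω j ∂μ + ∫ ω, h ω i * g ω j ∂μ := by
        rw [integral_add (integrable_finsetSum _ fun k _ => hint k) hint',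
          integral_finsetSum _ fun k _ => hint k]
        simp only [integral_const_mul]

theorem crossMoment_mulVec_add_self [Fintype m] {h : Ω → l → ℝ} (L : Matrix l m ℝ)
    (hf : ∀ i, MemLp (fun ω => f ω i) 2 μ) (hh : ∀ i, MemLp (fun ω => h ω i) 2 μ)
    (hfh : crossMoment μ f h = 0) :
    crossMoment μ (fun ω => L *ᵥ f ω + h ω) (fun ω => L *ᵥ f ω + h ω) =
      L * crossMoment μ f f * Lᵀ + crossMoment μ h h := by
  have hx := memLp_mulVec_add L hf hh
  have hhf : crossMoment μ h f = 0 := by rw [← crossMoment_transpose, hfh, Matrix.transpose_zero]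
  have hxf := congrArg Matrix.transpose (crossMoment_mulVec_add L hf hh hf)
  have hxh := congrArg Matrix.transpose (crossMoment_mulVec_add L hf hh hh)
  rw [crossMoment_transpose] at hxf hxh
  rw [crossMoment_mulVec_add L hf hh hx, hxf, hxh, hfh, hhf, Matrix.mul_zero, add_zero, zero_add,
    crossMoment_transpose, Matrix.transpose_mul, crossMoment_transpose, Matrix.mul_assoc]

theorem dotProduct_mulVec_eq_sum [Fintype m] [Fintype n] (Q : Matrix m n ℝ) (x : m → ℝ)
    (y : n → ℝ) : x ⬝ᵥ Q *ᵥ y = ∑ i, ∑ j, Q i j * (y j * x i) := by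
  simp only [dotProduct, Matrix.mulVec, Finset.mul_sum]
  exact Finset.sum_congr rfl fun i _ => Finset.sum_congr rfl fun j _ => by ring

theorem integrable_dotProduct_mulVec [Fintype m] [Fintype n] (Q : Matrix m n ℝ)
    (hf : ∀ i, MemLp (fun ω => f ω i) 2 μ) (hg : ∀ j, MemLp (fun ω => g ω j) 2 μ) :
    Integrable (fun ω => f ω ⬝ᵥ Q *ᵥ g ω) μ := by
  simp only [dotProduct_mulVec_eq_sum]
  exact integrable_finsetSum _ fun i _ => integrable_finsetSum _ fun j _ =>
    ((hg j).integrable_mul (hf i)).const_mul _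

theorem integral_dotProduct_mulVec [Fintype m] [Fintype n] (Q : Matrix m n ℝ)
    (hf : ∀ i, MemLp (fun ω => f ω i) 2 μ) (hg : ∀ j, MemLp (fun ω => g ω j) 2 μ) :
    ∫ ω, f ω ⬝ᵥ Q *ᵥ g ω ∂μ = (Q * crossMoment μ g f).trace := by
  have hint (i : m) (j : n) : Integrable (fun ω => Q i j * (g ω j * f ω i)) μ :=
    ((hg j).integrable_mul (hf i)).const_mul _
  simp only [dotProduct_mulVec_eq_sum]
  rw [integral_finsetSum _ fun i _ => integrable_finsetSum _ fun j _ => hint i j]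
  refine Finset.sum_congr rfl fun i _ => ?_
  rw [integral_finsetSum _ fun j _ => hint i j]
  simp only [integral_const_mul]
  rfl

end SecondMoments

section AverageCost

variable {dx du : ℕ}

instance isProbabilityMeasure_noiseLaw (dx : ℕ) : IsProbabilityMeasure (noiseLaw dx) := by
  unfold noiseLaw; infer_instance

theorem measurePreserving_noise (s : ℕ) (i : Fin dx) :
    MeasurePreserving (fun w : ℕ → Fin dx → ℝ => w s i) (noiseLaw dx) (gaussianReal 0 1) :=
  (measurePreserving_eval (fun _ : Fin dx => gaussianReal 0 1) i).comp
    (measurePreserving_eval_infinitePi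
      (fun _ : ℕ => Measure.pi fun _ : Fin dx => gaussianReal 0 1) s)

theorem memLp_noise (s : ℕ) (i : Fin dx) :
    MemLp (fun w : ℕ → Fin dx → ℝ => w s i) 2 (noiseLaw dx) :=
  (memLp_id_gaussianReal 2).comp_measurePreserving (measurePreserving_noise s i)

theorem integral_noise (s : ℕ) (i : Fin dx) : ∫ w, w s i ∂noiseLaw dx = 0 :=
  (measurePreserving_noise s i).hasLaw.integral_eq.trans integral_id_gaussianReal

theorem integral_noise_mul_self (s : ℕ) (i : Fin dx) :
    ∫ w, w s i * w s i ∂noiseLaw dx = 1 := by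
  have hvar := (measurePreserving_noise s i).hasLaw.variance_eq
  rw [variance_of_integral_eq_zero (measurePreserving_noise s i).measurable.aemeasurable
    (integral_noise s i), variance_id_gaussianReal] at hvar
  simpa [sq] using hvar

theorem iIndepFun_noise (dx : ℕ) :
    iIndepFun (fun (p : ℕ × Fin dx) (w : ℕ → Fin dx → ℝ) => w p.1 p.2) (noiseLaw dx) := by
  simpa only [noiseLaw, Measure.infinitePi_eq_pi] using
    iIndepFun_uncurry_infinitePi' (X := fun (_ : ℕ) (_ : Fin dx) (x : ℝ) => x)
      (fun (_ : ℕ) (_ : Fin dx) => gaussianReal 0 1) (fun _ _ => measurable_id)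

theorem integral_noise_mul_eq_zero {s t : ℕ} {i j : Fin dx} (h : (s, i) ≠ (t, j)) :
    ∫ w, w s i * w t j ∂noiseLaw dx = 0 := by
  rw [((iIndepFun_noise dx).indepFun h).integral_fun_mul_eq_mul_integral
    (memLp_noise s i).aestronglyMeasurable (memLp_noise t j).aestronglyMeasurable, integral_noise,
    zero_mul]

theorem crossMoment_noise_self (t : ℕ) : crossMoment (noiseLaw dx) (· t) (· t) = 1 := by
  ext i j
  rcases eq_or_ne i j with rfl | hij
  · exact (integral_noise_mul_self t i).trans (Matrix.one_apply_eq i).symm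
  · exact (integral_noise_mul_eq_zero fun h => hij (congrArg Prod.snd h)).trans
      (Matrix.one_apply_ne hij).symm

theorem crossMoment_noise_of_ne {s t : ℕ} (h : s ≠ t) :
    crossMoment (noiseLaw dx) (· s) (· t) = 0 := by
  ext i j
  exact integral_noise_mul_eq_zero fun hp => h (congrArg Prod.fst hp)

theorem state_succ (A : Matrix (Fin dx) (Fin dx) ℝ) (B : Matrix (Fin dx) (Fin du) ℝ)
    (K : Matrix (Fin du) (Fin dx) ℝ) (w : ℕ → Fin dx → ℝ) (t : ℕ) :
    state A B K w (t + 1) = (A + B * K) *ᵥ state A B K w t + w t := by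
  rw [state, Matrix.add_mulVec, Matrix.mulVec_mulVec]

theorem memLp_state (A : Matrix (Fin dx) (Fin dx) ℝ) (B : Matrix (Fin dx) (Fin du) ℝ)
    (K : Matrix (Fin du) (Fin dx) ℝ) (t : ℕ) (i : Fin dx) :
    MemLp (fun w => state A B K w t i) 2 (noiseLaw dx) := by
  induction t generalizing i with
  | zero => exact MemLp.zero
  | succ t ih =>
    simp only [state_succ]
    exact memLp_mulVec_add _ ih (memLp_noise t) i

theorem crossMoment_state_noise (A : Matrix (Fin dx) (Fin dx) ℝ) (B : Matrix (Fin dx) (Fin du) ℝ)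
    (K : Matrix (Fin du) (Fin dx) ℝ) {t s : ℕ} (hts : t ≤ s) :
    crossMoment (noiseLaw dx) (state A B K · t) (· s) = 0 := by
  induction t with
  | zero => ext i j; simp [crossMoment, state]
  | succ t ih =>
    simp only [state_succ]
    rw [crossMoment_mulVec_add _ (memLp_state A B K t) (memLp_noise t) (memLp_noise s),
      ih (by lia), crossMoment_noise_of_ne (by lia), Matrix.mul_zero, add_zero]

theorem crossMoment_state_succ (A : Matrix (Fin dx) (Fin dx) ℝ) (B : Matrix (Fin dx) (Fin du) ℝ)
    (K : Matrix (Fin du) (Fin dx) ℝ) (t : ℕ) :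
    crossMoment (noiseLaw dx) (state A B K · (t + 1)) (state A B K · (t + 1)) =
      lyapunovMap (A + B * K)ᵀ 1
        (crossMoment (noiseLaw dx) (state A B K · t) (state A B K · t)) := by
  simp only [state_succ]
  rw [crossMoment_mulVec_add_self _ (memLp_state A B K t) (memLp_noise t)
    (crossMoment_state_noise A B K le_rfl), crossMoment_noise_self, lyapunovMap,
    Matrix.transpose_transpose]

theorem crossMoment_state (A : Matrix (Fin dx) (Fin dx) ℝ) (B : Matrix (Fin dx) (Fin du) ℝ)
    (K : Matrix (Fin du) (Fin dx) ℝ) (t : ℕ) :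
    crossMoment (noiseLaw dx) (state A B K · t) (state A B K · t) =
      ∑ j ∈ Finset.range t, (A + B * K) ^ j * ((A + B * K) ^ j)ᵀ := by
  have hiter : crossMoment (noiseLaw dx) (state A B K · t) (state A B K · t) =
      (lyapunovMap (A + B * K)ᵀ 1)^[t] 0 := by
    induction t with
    | zero => ext i j; simp [crossMoment, state]
    | succ t ih => rw [crossMoment_state_succ, ih, Function.iterate_succ_apply']
  simp only [hiter, iterate_lyapunovMap_zero, ← Matrix.transpose_pow, Matrix.transpose_transpose,
    Matrix.mul_one]

theorem integral_quadratic_state (A : Matrix (Fin dx) (Fin dx) ℝ) (B : Matrix (Fin dx) (Fin du) ℝ)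
    (K : Matrix (Fin du) (Fin dx) ℝ) (Q : Matrix (Fin dx) (Fin dx) ℝ) (t : ℕ) :
    ∫ w, state A B K w t ⬝ᵥ Q *ᵥ state A B K w t ∂noiseLaw dx =
      ((lyapunovMap (A + B * K) Q)^[t] 0).trace := by
  rw [integral_dotProduct_mulVec Q (memLp_state A B K t) (memLp_state A B K t), crossMoment_state,
    iterate_lyapunovMap_zero, Finset.mul_sum, Matrix.trace_sum, Matrix.trace_sum]
  exact Finset.sum_congr rfl fun j _ => by rw [← Matrix.mul_assoc, Matrix.trace_mul_comm,
    Matrix.mul_assoc]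

variable {Rx A P : Matrix (Fin dx) (Fin dx) ℝ} {Ru : Matrix (Fin du) (Fin du) ℝ}
  {B : Matrix (Fin dx) (Fin du) ℝ} {K : Matrix (Fin du) (Fin dx) ℝ}

theorem stageCost_mulVec (Rx : Matrix (Fin dx) (Fin dx) ℝ) (Ru : Matrix (Fin du) (Fin du) ℝ)
    (K : Matrix (Fin du) (Fin dx) ℝ) (x : Fin dx → ℝ) :
    stageCost Rx Ru x (K *ᵥ x) = x ⬝ᵥ (Rx + Kᵀ * Ru * K) *ᵥ x := by
  rw [stageCost, Matrix.add_mulVec, dotProduct_add, ← Matrix.mulVec_mulVec, ← Matrix.mulVec_mulVec,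
    Matrix.dotProduct_mulVec x Kᵀ, Matrix.vecMul_transpose]

theorem integral_sum_stageCost (Rx A : Matrix (Fin dx) (Fin dx) ℝ) (Ru : Matrix (Fin du) (Fin du) ℝ)
    (B : Matrix (Fin dx) (Fin du) ℝ) (K : Matrix (Fin du) (Fin dx) ℝ) (T : ℕ) :
    ∫ w, ∑ t ∈ Finset.range T,
      stageCost Rx Ru (state A B K w t) (K *ᵥ state A B K w t) ∂(noiseLaw dx) =
    ∑ t ∈ Finset.range T, ((policyMap Rx Ru A B K)^[t] 0).trace := by
  simp only [stageCost_mulVec]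
  rw [integral_finsetSum _ fun t _ =>
    integrable_dotProduct_mulVec _ (memLp_state A B K t) (memLp_state A B K t)]
  simp only [integral_quadratic_state, policyMap]

theorem hasAverageCost_of_isLyapunovSolution (hRx : 1 ≤ Rx) (hRu : 0 ≤ Ru)
    (h : IsLyapunovSolution (A + B * K) (Rx + Kᵀ * Ru * K) P) :
    HasAverageCost Rx Ru A B K P.trace := by
  have hlim := h.tendsto_iterate (one_le_policyCost hRx hRu K)
  have htrace := ((continuous_id.matrix_trace.tendsto P).comp hlim).cesaro
  simpa only [HasAverageCost, integral_sum_stageCost, one_div, policyMap, Function.comp_apply, id]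
    using htrace

/-- Value iteration bounds every finite-horizon cost from below, hence its limit bounds every
average cost. -/
theorem IsDARESolution.trace_le_of_hasAverageCost (h : IsDARESolution Rx Ru A B P) (hRx : 1 ≤ Rx)
    (hRu : Ru.PosDef) {J : ℝ} (hJ : HasAverageCost Rx Ru A B K J) : P.trace ≤ J := by
  have htrace := (continuous_id.matrix_trace.tendsto P).comp (h.tendsto_iterate hRx hRu)
  refine le_of_tendsto_of_tendsto' htrace.cesaro hJ fun T => ?_
  rw [integral_sum_stageCost, one_div]
  gcongr with t
  exact trace_mono (iterate_riccatiMap_le (zero_le_one.trans hRx) hRu A B K t)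

theorem IsDARESolution.isOptimalCost (h : IsDARESolution Rx Ru A B P) (hRx : 1 ≤ Rx)
    (hRu : Ru.PosDef) : IsOptimalCost Rx Ru A B P.trace :=
  ⟨⟨gain Ru A B P, hasAverageCost_of_isLyapunovSolution hRx hRu.posSemidef.nonneg
    (h.isLyapunovSolution hRu)⟩, fun _ ⟨_, hJ⟩ => h.trace_le_of_hasAverageCost hRx hRu hJ⟩

end AverageCost

section Perturbation

variable {dx du : ℕ} {Rx A A' S S' : Matrix (Fin dx) (Fin dx) ℝ}
  {Ru : Matrix (Fin du) (Fin du) ℝ} {B B' : Matrix (Fin dx) (Fin du) ℝ}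
  {N : ∀ {a b : ℕ}, Matrix (Fin a) (Fin b) ℝ → ℝ}

/-- The optimal closed loop of `(A, B)` with value matrix `SᵀS`, in the coordinates `S x`. Since
the value function is the squared Euclidean norm in these coordinates, it is a contraction. -/
noncomputable def normalizedLoop (Ru : Matrix (Fin du) (Fin du) ℝ) (A : Matrix (Fin dx) (Fin dx) ℝ)
    (B : Matrix (Fin dx) (Fin du) ℝ) (S : Matrix (Fin dx) (Fin dx) ℝ) :
    Matrix (Fin dx) (Fin dx) ℝ :=
  S * closedLoop Ru A B (Sᵀ * S) * S⁻¹

/-- The difference of two value matrices `S'ᵀS'` and `SᵀS`, as a bilinear form in the coordinates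
`S x` on the left and `S' x` on the right. -/
noncomputable def normalizedSub (S S' : Matrix (Fin dx) (Fin dx) ℝ) : Matrix (Fin dx) (Fin dx) ℝ :=
  S⁻¹ᵀ * (S'ᵀ * S' - Sᵀ * S) * S'⁻¹

theorem transpose_mul_normalizedSub_mul (hS : IsUnit S.det) (hS' : IsUnit S'.det) :
    Sᵀ * normalizedSub S S' * S' = S'ᵀ * S' - Sᵀ * S := by
  have hST : Sᵀ * S⁻¹ᵀ = 1 := by
    rw [← Matrix.transpose_mul, Matrix.nonsing_inv_mul _ hS, Matrix.transpose_one]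
  calc Sᵀ * normalizedSub S S' * S'
      = Sᵀ * S⁻¹ᵀ * (S'ᵀ * S' - Sᵀ * S) * (S'⁻¹ * S') := by
        simp only [normalizedSub, Matrix.mul_assoc]
    _ = S'ᵀ * S' - Sᵀ * S := by
        rw [hST, Matrix.nonsing_inv_mul _ hS', Matrix.one_mul, Matrix.mul_one]

theorem IsLyapunovSolution.opNorm_conj_sq_le {X Y : Matrix (Fin dx) (Fin dx) ℝ}
    (h : IsLyapunovSolution X Y (Sᵀ * S)) (hY : 1 ≤ Y) {q : ℝ} (hq : 1 ≤ q)
    (hS : opNorm S ^ 2 ≤ q) : opNorm (S * X * S⁻¹) ^ 2 ≤ 1 - q⁻¹ := by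
  have hq0 : 0 < q := one_pos.trans_le hq
  have hr : √(1 - q⁻¹) ^ 2 = 1 - q⁻¹ := Real.sq_sqrt (sub_nonneg.2 (inv_le_one_of_one_le₀ hq))
  have hS1 : q⁻¹ • (Sᵀ * S) ≤ 1 := calc
    q⁻¹ • (Sᵀ * S) ≤ q⁻¹ • q • (1 : Matrix (Fin dx) (Fin dx) ℝ) :=
      smul_le_smul_of_nonneg_left ((transpose_mul_self_le S).trans
        (smul_le_smul_of_nonneg_right hS zero_le_one)) (inv_nonneg.2 hq0.le)
    _ = 1 := inv_smul_smul₀ hq0.ne' 1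
  have hle : (S * X)ᵀ * (S * X) ≤ √(1 - q⁻¹) ^ 2 • (Sᵀ * S) := calc
    (S * X)ᵀ * (S * X) = Sᵀ * S - Y := by
      rw [eq_sub_iff_add_eq, Matrix.transpose_mul]
      simpa only [Matrix.mul_assoc] using h.2.symm
    _ ≤ Sᵀ * S - q⁻¹ • (Sᵀ * S) := sub_le_sub_left (hS1.trans hY) _
    _ = √(1 - q⁻¹) ^ 2 • (Sᵀ * S) := by rw [hr, sub_smul, one_smul]
  rw [← hr]
  exact pow_le_pow_left₀ (opNorm_nonneg _)
    (opNorm_mul_inv_le (Real.sqrt_nonneg _) (isUnit_det_of_one_le (hY.trans h.le)) hle) 2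

theorem IsDARESolution.opNorm_normalizedLoop_sq_le (h : IsDARESolution Rx Ru A B (Sᵀ * S))
    (hRx : 1 ≤ Rx) (hRu : Ru.PosDef) {q : ℝ} (hq : 1 ≤ q) (hS : opNorm S ^ 2 ≤ q) :
    opNorm (normalizedLoop Ru A B S) ^ 2 ≤ 1 - q⁻¹ :=
  (h.isLyapunovSolution hRu).opNorm_conj_sq_le (one_le_policyCost hRx hRu.posSemidef.nonneg _) hq hS

theorem IsDARESolution.opNorm_normalizedLoop_le_one (h : IsDARESolution Rx Ru A B (Sᵀ * S))
    (hRx : 1 ≤ Rx) (hRu : Ru.PosDef) : opNorm (normalizedLoop Ru A B S) ≤ 1 := by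
  have hsq := h.opNorm_normalizedLoop_sq_le hRx hRu (le_max_left 1 _) (le_max_right 1 _)
  have hinv : 0 ≤ (max 1 (opNorm S ^ 2))⁻¹ := by positivity
  exact (sq_le_one_iff₀ (opNorm_nonneg _)).1 (by linarith)

theorem IsDARESolution.transpose_gain_mul_gain_le {P : Matrix (Fin dx) (Fin dx) ℝ}
    (h : IsDARESolution Rx Ru A B P) (hRx : 0 ≤ Rx) (hRu : 1 ≤ Ru) :
    (gain Ru A B P)ᵀ * gain Ru A B P ≤ P := calc
  (gain Ru A B P)ᵀ * gain Ru A B P ≤ (gain Ru A B P)ᵀ * Ru * gain Ru A B P := by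
    simpa using transpose_mul_mul_mono hRu (gain Ru A B P)
  _ ≤ Rx + (gain Ru A B P)ᵀ * Ru * gain Ru A B P := le_add_of_nonneg_left hRx
  _ ≤ P := (h.isLyapunovSolution (posDef_of_one_le hRu)).le

theorem IsDARESolution.opNorm_gain_mul_inv_le_one (h : IsDARESolution Rx Ru A B (Sᵀ * S))
    (hRx : 1 ≤ Rx) (hRu : 1 ≤ Ru) : opNorm (gain Ru A B (Sᵀ * S) * S⁻¹) ≤ 1 := by
  refine opNorm_mul_inv_le zero_le_one
    (isUnit_det_of_one_le (hRx.trans (h.le (posDef_of_one_le hRu)))) ?_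
  rw [one_pow, one_smul]
  exact h.transpose_gain_mul_gain_le (zero_le_one.trans hRx) hRu

theorem IsOperatorIdealNorm.error_mul_inv_le (hN : IsOperatorIdealNorm N)
    (h : IsDARESolution Rx Ru A B (Sᵀ * S)) (hRx : 1 ≤ Rx) (hRu : 1 ≤ Ru)
    {E : Matrix (Fin dx) (Fin dx) ℝ} {F : Matrix (Fin dx) (Fin du) ℝ} {ε : ℝ} (hE : N E ≤ ε)
    (hF : N F ≤ ε) : N ((E + F * gain Ru A B (Sᵀ * S)) * S⁻¹) ≤ 2 * ε := by
  have hS := opNorm_inv_le_one (hRx.trans (h.le (posDef_of_one_le hRu)))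
  have hK := h.opNorm_gain_mul_inv_le_one hRx hRu
  rw [Matrix.add_mul, Matrix.mul_assoc]
  linarith [hN.add_le (E * S⁻¹) (F * (gain Ru A B (Sᵀ * S) * S⁻¹)), hN.mul_le' hE hS,
    hN.mul_le' hF hK]

theorem IsDARESolution.normalizedSub_eq (h : IsDARESolution Rx Ru A B (Sᵀ * S))
    (h' : IsDARESolution Rx Ru A' B' (S'ᵀ * S')) (hRx : 1 ≤ Rx) (hRu : Ru.PosDef) :
    normalizedSub S S' = (normalizedLoop Ru A B S)ᵀ * normalizedSub S S' *
        normalizedLoop Ru A' B' S'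
      + (((A' - A + (B' - B) * gain Ru A B (Sᵀ * S)) * S⁻¹)ᵀ *
          (S'ᵀ * normalizedLoop Ru A' B' S')
        + (normalizedLoop Ru A B S)ᵀ *
          (S * ((A' - A + (B' - B) * gain Ru A' B' (S'ᵀ * S')) * S'⁻¹))) := by
  have hsub := transpose_mul_normalizedSub_mul (isUnit_det_of_one_le (hRx.trans (h.le hRu)))
    (isUnit_det_of_one_le (hRx.trans (h'.le hRu)))
  nth_rw 1 [normalizedSub]
  rw [h.sub_eq h' (zero_le_one.trans hRx) hRu, ← hsub]
  generalize A' - A + (B' - B) * gain Ru A B (Sᵀ * S) = E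
  simp only [normalizedLoop, Matrix.transpose_mul, Matrix.mul_add, Matrix.add_mul,
    Matrix.mul_assoc]

theorem IsOperatorIdealNorm.normalizedSub_le (hN : IsOperatorIdealNorm N)
    (h : IsDARESolution Rx Ru A B (Sᵀ * S)) (h' : IsDARESolution Rx Ru A' B' (S'ᵀ * S'))
    (hRx : 1 ≤ Rx) (hRu : 1 ≤ Ru) {s ε : ℝ} (hs : 1 ≤ s) (hS : opNorm S ≤ s)
    (hS' : opNorm S' ≤ s) (hA : N (A' - A) ≤ ε) (hB : N (B' - B) ≤ ε) :
    N (normalizedSub S S') ≤ 4 * s ^ 3 * ε := by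
  have hRu' := posDef_of_one_le hRu
  have hM := h.opNorm_normalizedLoop_le_one hRx hRu'
  have hM' := h'.opNorm_normalizedLoop_le_one hRx hRu'
  have hq : 1 ≤ s ^ 2 := one_le_pow₀ hs
  have hcontr := hN.le_mul_of_eq_add (zero_lt_one.trans_le hq)
    (h.opNorm_normalizedLoop_sq_le hRx hRu' hq (pow_le_pow_left₀ (opNorm_nonneg _) hS 2))
    (h'.opNorm_normalizedLoop_sq_le hRx hRu' hq (pow_le_pow_left₀ (opNorm_nonneg _) hS' 2))
    (h.normalizedSub_eq h' hRx hRu')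
  have hE := (hN.transpose _).trans_le (hN.error_mul_inv_le h hRx hRu hA hB)
  have hE' := hN.error_mul_inv_le h' hRx hRu hA hB
  have hS't := (opNorm_transpose S').trans_le hS'
  have hMt := (opNorm_transpose _).trans_le hM
  have hleft := hN.mul_le' hE (isOperatorIdealNorm_opNorm.mul_le hS't hM')
  have hright := hN.mul_le hMt (hN.mul_le hS hE')
  calc N (normalizedSub S S') ≤ s ^ 2 * (2 * ε * (s * 1) + 1 * (s * (2 * ε))) :=
        hcontr.trans (mul_le_mul_of_nonneg_left ((hN.add_le _ _).trans (add_le_add hleft hright))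
          (sq_nonneg s))
    _ = 4 * s ^ 3 * ε := by ring

theorem IsDARESolution.mul_gain_sub_eq (h : IsDARESolution Rx Ru A B (Sᵀ * S))
    (h' : IsDARESolution Rx Ru A' B' (S'ᵀ * S')) (hRx : 1 ≤ Rx) (hRu : Ru.PosDef)
    {T : Matrix (Fin du) (Fin du) ℝ} (hT : Tᵀ * T = Ru + Bᵀ * (Sᵀ * S) * B) :
    T * (gain Ru A B (Sᵀ * S) - gain Ru A' B' (S'ᵀ * S')) =
      T⁻¹ᵀ * ((B' - B)ᵀ * (S'ᵀ * (normalizedLoop Ru A' B' S' * S')))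
        + ((S * B * T⁻¹)ᵀ * (normalizedSub S S' * (normalizedLoop Ru A' B' S' * S'))
          + (S * B * T⁻¹)ᵀ * (S * (((A' - A + (B' - B) * gain Ru A' B' (S'ᵀ * S')) * S'⁻¹) *
            S'))) := by
  have hS := isUnit_det_of_one_le (hRx.trans (h.le hRu))
  have hS' := isUnit_det_of_one_le (hRx.trans (h'.le hRu))
  have hTdet : IsUnit Tᵀ.det := isUnit_of_mul_isUnit_left (y := T.det)
    (by rw [← Matrix.det_mul, hT]; exact isUnit_det_inputCost hRu h.nonneg B)
  calc T * (gain Ru A B (Sᵀ * S) - gain Ru A' B' (S'ᵀ * S'))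
      = T⁻¹ᵀ * ((Ru + Bᵀ * (Sᵀ * S) * B) *
          (gain Ru A B (Sᵀ * S) - gain Ru A' B' (S'ᵀ * S'))) := by
        rw [← hT, Matrix.transpose_nonsing_inv, Matrix.mul_assoc,
          Matrix.nonsing_inv_mul_cancel_left _ _ hTdet]
    _ = _ := by
        rw [h.inputCost_mul_gain_sub h' hRu, ← transpose_mul_normalizedSub_mul hS hS']
        simp only [normalizedLoop, Matrix.transpose_mul, Matrix.mul_add, Matrix.mul_assoc,
          Matrix.nonsing_inv_mul _ hS', Matrix.mul_one, add_assoc]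

theorem IsOperatorIdealNorm.mul_gain_sub_le (hN : IsOperatorIdealNorm N)
    (h : IsDARESolution Rx Ru A B (Sᵀ * S)) (h' : IsDARESolution Rx Ru A' B' (S'ᵀ * S'))
    (hRx : 1 ≤ Rx) (hRu : 1 ≤ Ru) {s ε : ℝ} (hs : 1 ≤ s) (hS : opNorm S ≤ s)
    (hS' : opNorm S' ≤ s) (hA : N (A' - A) ≤ ε) (hB : N (B' - B) ≤ ε)
    {T : Matrix (Fin du) (Fin du) ℝ} (hT : Tᵀ * T = Ru + Bᵀ * (Sᵀ * S) * B) :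
    N (T * (gain Ru A B (Sᵀ * S) - gain Ru A' B' (S'ᵀ * S'))) ≤ 7 * s ^ 4 * ε := by
  have hRu' := posDef_of_one_le hRu
  have hε : 0 ≤ ε := (hN.nonneg _).trans hA
  have hT1 : 1 ≤ Tᵀ * T := hT ▸ one_le_inputCost hRu h.nonneg B
  have hTinv := (opNorm_transpose _).trans_le (opNorm_inv_le_one hT1)
  have hSB : opNorm (S * B * T⁻¹)ᵀ ≤ 1 := by
    rw [opNorm_transpose]
    refine opNorm_mul_inv_le zero_le_one (isUnit_det_of_one_le hT1) ?_
    rw [one_pow, one_smul, hT, Matrix.transpose_mul]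
    simpa only [Matrix.mul_assoc] using
      le_add_of_nonneg_left (a := Bᵀ * (Sᵀ * S) * B) (zero_le_one.trans hRu)
  have hloop := isOperatorIdealNorm_opNorm.mul_le (h'.opNorm_normalizedLoop_le_one hRx hRu') hS'
  have hS't := (opNorm_transpose S').trans_le hS'
  have hBt := (hN.transpose _).trans_le hB
  have hD := hN.normalizedSub_le h h' hRx hRu hs hS hS' hA hB
  have hE' := hN.error_mul_inv_le h' hRx hRu hA hB
  have hterm₁ := hN.mul_le hTinv (hN.mul_le' hBt (isOperatorIdealNorm_opNorm.mul_le hS't hloop))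
  have hterm₂ := hN.mul_le hSB (hN.mul_le' hD hloop)
  have hterm₃ := hN.mul_le hSB (hN.mul_le hS (hN.mul_le' hE' hS'))
  rw [h.mul_gain_sub_eq h' hRx hRu' hT]
  calc _ ≤ 1 * (ε * (s * (1 * s))) + (1 * (4 * s ^ 3 * ε * (1 * s)) + 1 * (s * (2 * ε * s))) :=
        (hN.add_le _ _).trans (add_le_add hterm₁ ((hN.add_le _ _).trans
          (add_le_add hterm₂ hterm₃)))
    _ = 4 * s ^ 4 * ε + 3 * (s ^ 2 * ε) := by ring
    _ ≤ 4 * s ^ 4 * ε + 3 * (s ^ 4 * ε) := by gcongr; norm_num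
    _ = 7 * s ^ 4 * ε := by ring

theorem IsOperatorIdealNorm.mul_gain_sub_le_of_opNorm_le (hN : IsOperatorIdealNorm N)
    {P P' : Matrix (Fin dx) (Fin dx) ℝ} (h : IsDARESolution Rx Ru A B P)
    (h' : IsDARESolution Rx Ru A' B' P') (hRx : 1 ≤ Rx) (hRu : 1 ≤ Ru) {q ε : ℝ} (hq : 1 ≤ q)
    (hP : opNorm P ≤ q) (hP' : opNorm P' ≤ q) (hA : N (A' - A) ≤ ε) (hB : N (B' - B) ≤ ε)
    {T : Matrix (Fin du) (Fin du) ℝ} (hT : Tᵀ * T = Ru + Bᵀ * P * B) :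
    N (T * (gain Ru A B P - gain Ru A' B' P')) ≤ 7 * q ^ 2 * ε := by
  obtain ⟨S, rfl⟩ := exists_eq_transpose_mul_self h.nonneg
  obtain ⟨S', rfl⟩ := exists_eq_transpose_mul_self h'.nonneg
  rw [opNorm_transpose_mul_self] at hP hP'
  have hsq : √q ^ 4 = q ^ 2 := by
    rw [show 4 = 2 * 2 from rfl, pow_mul, Real.sq_sqrt (zero_le_one.trans hq)]
  rw [← hsq]
  exact hN.mul_gain_sub_le h h' hRx hRu (Real.one_le_sqrt.2 hq) (Real.le_sqrt_of_sq_le hP)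
    (Real.le_sqrt_of_sq_le hP') hA hB hT

end Perturbation

section Robustness

variable {dx du : ℕ} {Rx A A' P : Matrix (Fin dx) (Fin dx) ℝ}
  {Ru : Matrix (Fin du) (Fin du) ℝ} {B B' : Matrix (Fin dx) (Fin du) ℝ}

theorem lyapunovMap_smul_le {a : ℕ} {X Y P : Matrix (Fin a) (Fin a) ℝ} {δ : ℝ} (hδ : δ < 1)
    (h : Xᵀ * P * X + (1 - δ) • Y ≤ P) :
    lyapunovMap X Y ((1 - δ)⁻¹ • P) ≤ (1 - δ)⁻¹ • P := by
  have hδ' : 0 < 1 - δ := sub_pos.2 hδ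
  calc lyapunovMap X Y ((1 - δ)⁻¹ • P) = (1 - δ)⁻¹ • (Xᵀ * P * X + (1 - δ) • Y) := by
        rw [lyapunovMap, Matrix.mul_smul, Matrix.smul_mul, smul_add, inv_smul_smul₀ hδ'.ne']
    _ ≤ (1 - δ)⁻¹ • P := smul_le_smul_of_nonneg_left h (inv_nonneg.2 hδ'.le)

theorem IsLyapunovSolution.lyapunovMap_add_smul_le {a : ℕ} {X Y P E : Matrix (Fin a) (Fin a) ℝ}
    (h : IsLyapunovSolution X Y P) (hY : 1 ≤ Y) {δ : ℝ} (hδ : δ < 1)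
    (hE : opNorm P * (2 * opNorm E + opNorm E ^ 2) ≤ δ) :
    lyapunovMap (X + E) Y ((1 - δ)⁻¹ • P) ≤ (1 - δ)⁻¹ • P := by
  obtain ⟨S, rfl⟩ := exists_eq_transpose_mul_self h.nonneg
  have hsum : (S * X)ᵀ * (S * X) + Y = Sᵀ * S := by
    simpa only [Matrix.transpose_mul, Matrix.mul_assoc] using h.2.symm
  have hSX : opNorm (S * X) ≤ opNorm S := by
    refine (pow_le_pow_iff_left₀ (opNorm_nonneg _) (opNorm_nonneg _) two_ne_zero).1 ?_
    rw [← opNorm_transpose_mul_self S]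
    exact opNorm_sq_le ((le_add_of_nonneg_right (zero_le_one.trans hY)).trans_eq hsum)
  have hcross : 2 * (opNorm (S * X) * opNorm (S * E)) + opNorm (S * E) ^ 2 ≤ δ := by
    have hSE := opNorm_mul_le S E
    rw [opNorm_transpose_mul_self] at hE
    calc 2 * (opNorm (S * X) * opNorm (S * E)) + opNorm (S * E) ^ 2
        ≤ 2 * (opNorm S * (opNorm S * opNorm E)) + (opNorm S * opNorm E) ^ 2 := by
          have := opNorm_nonneg S
          have := opNorm_nonneg (S * E)
          gcongr
      _ = opNorm S ^ 2 * (2 * opNorm E + opNorm E ^ 2) := by ring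
      _ ≤ δ := hE
  refine lyapunovMap_smul_le hδ ?_
  calc (X + E)ᵀ * (Sᵀ * S) * (X + E) + (1 - δ) • Y
      = (S * X + S * E)ᵀ * (S * X + S * E) + (1 - δ) • Y := by
        rw [← Matrix.mul_add, Matrix.transpose_mul]
        simp only [Matrix.mul_assoc]
    _ ≤ (S * X)ᵀ * (S * X) + δ • (1 : Matrix (Fin a) (Fin a) ℝ) + (1 - δ) • Y := by
        gcongr
        exact (transpose_mul_self_add_le _ _).trans
          (add_le_add_right (smul_le_smul_of_nonneg_right hcross zero_le_one) _)
    _ ≤ (S * X)ᵀ * (S * X) + δ • Y + (1 - δ) • Y := by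
        have hδ0 : 0 ≤ δ := by
          refine le_trans ?_ hE
          have := opNorm_nonneg (Sᵀ * S)
          have := opNorm_nonneg E
          positivity
        gcongr
    _ = Sᵀ * S := by rw [add_assoc, ← add_smul, add_sub_cancel, one_smul, hsum]

theorem IsDARESolution.policyMap_smul_le (h : IsDARESolution Rx Ru A B P) (hRx : 1 ≤ Rx)
    (hRu : 1 ≤ Ru) {p ε δ : ℝ} (hp : 1 ≤ p) (hP : opNorm P ≤ p) (hA : opNorm (A' - A) ≤ ε)
    (hB : opNorm (B' - B) ≤ ε) (hδ : δ < 1) (hε : 4 * (p ^ 2 * ε) + 4 * (p ^ 2 * ε ^ 2) ≤ δ) :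
    policyMap Rx Ru A' B' (gain Ru A B P) ((1 - δ)⁻¹ • P) ≤ (1 - δ)⁻¹ • P := by
  have hRu' := posDef_of_one_le hRu
  have hε0 : 0 ≤ ε := (opNorm_nonneg _).trans hA
  set k := opNorm (gain Ru A B P)
  have hk : k ^ 2 ≤ p :=
    (opNorm_sq_le (h.transpose_gain_mul_gain_le (zero_le_one.trans hRx) hRu)).trans hP
  set E := A' - A + (B' - B) * gain Ru A B P
  have hE : opNorm E ≤ ε * (1 + k) := by
    have hBK := isOperatorIdealNorm_opNorm.mul_le hB (le_refl k)
    linarith [opNorm_add_le (A' - A) ((B' - B) * gain Ru A B P)]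
  have hsmall : opNorm P * (2 * opNorm E + opNorm E ^ 2) ≤ δ := calc
    opNorm P * (2 * opNorm E + opNorm E ^ 2)
      ≤ p * (2 * (ε * (1 + k)) + (ε * (1 + k)) ^ 2) := by
        have := opNorm_nonneg E
        gcongr
    _ = p * (2 * ε * (1 + k) + ε ^ 2 * (1 + k) ^ 2) := by ring
    _ ≤ p * (2 * ε * (2 * p) + ε ^ 2 * (4 * p)) := by
        gcongr <;> nlinarith [sq_nonneg (k - 1)]
    _ ≤ δ := by linarith
  have hX : A' + B' * gain Ru A B P = closedLoop Ru A B P + E := by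
    simp only [E, closedLoop, Matrix.sub_mul]; abel
  rw [policyMap, hX]
  exact (h.isLyapunovSolution hRu').lyapunovMap_add_smul_le
    (one_le_policyCost hRx hRu'.posSemidef.nonneg _) hδ hsmall

end Robustness

section Suboptimality

/-- An operator ideal norm whose square is a seminorm of `XᵀX`, as in Bhatia's notion of a Q-norm.
Only the triangle inequality of that seminorm is recorded. -/
structure IsQNorm (N : ∀ {a b : ℕ}, Matrix (Fin a) (Fin b) ℝ → ℝ) : Prop extends
    IsOperatorIdealNorm N where
  sq_le_add_sq : ∀ {a b c d : ℕ} {X : Matrix (Fin a) (Fin d) ℝ} {Y : Matrix (Fin b) (Fin d) ℝ}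
    {Z : Matrix (Fin c) (Fin d) ℝ}, Xᵀ * X = Yᵀ * Y + Zᵀ * Z → N X ^ 2 ≤ N Y ^ 2 + N Z ^ 2

theorem isQNorm_opNorm : IsQNorm opNorm where
  toIsOperatorIdealNorm := isOperatorIdealNorm_opNorm
  sq_le_add_sq h := by
    simp only [← opNorm_transpose_mul_self, h]
    exact opNorm_add_le _ _

theorem isQNorm_frobNorm : IsQNorm frobNorm where
  toIsOperatorIdealNorm := isOperatorIdealNorm_frobNorm
  sq_le_add_sq h := by simp only [frobNorm_sq, h, Matrix.trace_add, le_refl]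

theorem IsQNorm.sq_mul_inv_le_of_isLyapunovSolution
    {N : ∀ {a b : ℕ}, Matrix (Fin a) (Fin b) ℝ → ℝ} (hN : IsQNorm N) {a b c : ℕ}
    {X Y S : Matrix (Fin a) (Fin a) ℝ} (h : IsLyapunovSolution X Y (Sᵀ * S)) (hY : 1 ≤ Y) {p : ℝ}
    (hp : 1 ≤ p) (hSp : opNorm S ^ 2 ≤ p) {Z : Matrix (Fin b) (Fin a) ℝ}
    {G : Matrix (Fin c) (Fin a) ℝ} (hZ : Zᵀ * Z = (Z * X)ᵀ * (Z * X) + Gᵀ * G) :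
    N (Z * S⁻¹) ^ 2 ≤ p * N G ^ 2 := by
  have hS1 : 1 ≤ Sᵀ * S := hY.trans h.le
  have hconj : Z * S⁻¹ * (S * X * S⁻¹) = Z * X * S⁻¹ := by
    simp only [Matrix.mul_assoc, Matrix.nonsing_inv_mul_cancel_left _ _ (isUnit_det_of_one_le hS1)]
  have hZS : (Z * S⁻¹)ᵀ * (Z * S⁻¹) = (Z * S⁻¹ * (S * X * S⁻¹))ᵀ * (Z * S⁻¹ * (S * X * S⁻¹)) +
      (G * S⁻¹)ᵀ * (G * S⁻¹) := by
    have hcongr := congrArg (fun M => S⁻¹ᵀ * M * S⁻¹) hZ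
    rw [hconj]
    simpa only [Matrix.mul_add, Matrix.add_mul, Matrix.transpose_mul, Matrix.mul_assoc]
      using hcongr
  have hloop : N (Z * S⁻¹ * (S * X * S⁻¹)) ^ 2 ≤ N (Z * S⁻¹) ^ 2 * (1 - p⁻¹) := calc
    N (Z * S⁻¹ * (S * X * S⁻¹)) ^ 2 ≤ (N (Z * S⁻¹) * opNorm (S * X * S⁻¹)) ^ 2 :=
      pow_le_pow_left₀ (hN.nonneg _) (hN.mul_le_mul_opNorm _ _) 2
    _ ≤ N (Z * S⁻¹) ^ 2 * (1 - p⁻¹) := by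
      rw [mul_pow]
      exact mul_le_mul_of_nonneg_left (h.opNorm_conj_sq_le hY hp hSp) (sq_nonneg _)
  have hG : N (G * S⁻¹) ^ 2 ≤ N G ^ 2 := pow_le_pow_left₀ (hN.nonneg _)
    ((hN.mul_le' le_rfl (opNorm_inv_le_one hS1)).trans_eq (mul_one _)) 2
  rw [← inv_mul_le_iff₀ (one_pos.trans_le hp)]
  linarith [hN.sq_le_add_sq hZS]

theorem IsQNorm.sq_le_of_isLyapunovSolution {N : ∀ {a b : ℕ}, Matrix (Fin a) (Fin b) ℝ → ℝ}
    (hN : IsQNorm N) {a b c : ℕ} {X Y P : Matrix (Fin a) (Fin a) ℝ}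
    (h : IsLyapunovSolution X Y P) (hY : 1 ≤ Y) {p : ℝ} (hp : 1 ≤ p) (hP : opNorm P ≤ p)
    {Z : Matrix (Fin b) (Fin a) ℝ} {G : Matrix (Fin c) (Fin a) ℝ}
    (hZ : Zᵀ * Z = (Z * X)ᵀ * (Z * X) + Gᵀ * G) : N Z ^ 2 ≤ p ^ 2 * N G ^ 2 := by
  obtain ⟨S, rfl⟩ := exists_eq_transpose_mul_self h.nonneg
  rw [opNorm_transpose_mul_self] at hP
  have hbound := hN.sq_mul_inv_le_of_isLyapunovSolution h hY hp hP hZ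
  calc N Z ^ 2 = N (Z * S⁻¹ * S) ^ 2 := by
        rw [Matrix.mul_assoc, Matrix.nonsing_inv_mul _ (isUnit_det_of_one_le (hY.trans h.le)),
          Matrix.mul_one]
    _ ≤ (N (Z * S⁻¹) * opNorm S) ^ 2 :=
        pow_le_pow_left₀ (hN.nonneg _) (hN.mul_le_mul_opNorm _ _) 2
    _ ≤ p * N G ^ 2 * p := by
        rw [mul_pow]
        exact mul_le_mul hbound hP (sq_nonneg _) (by positivity)
    _ = p ^ 2 * N G ^ 2 := by ring

variable {dx du : ℕ} {Rx A P V : Matrix (Fin dx) (Fin dx) ℝ} {Ru T : Matrix (Fin du) (Fin du) ℝ}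
  {B : Matrix (Fin dx) (Fin du) ℝ} {K : Matrix (Fin du) (Fin dx) ℝ}

theorem IsDARESolution.le_of_isLyapunovSolution (h : IsDARESolution Rx Ru A B P)
    (hV : IsLyapunovSolution (A + B * K) (Rx + Kᵀ * Ru * K) V) (hRx : 1 ≤ Rx)
    (hRu : Ru.PosDef) : P ≤ V := by
  obtain ⟨Q, hQ, hQV, -⟩ := exists_isDARESolution_of_le (zero_le_one.trans hRx) hRu hV.nonneg
    (isLyapunovSolution_iff.1 hV).2.le
  rwa [h.eq hQ hRx hRu]

theorem IsDARESolution.value_sub_eq (h : IsDARESolution Rx Ru A B P)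
    (hV : IsLyapunovSolution (A + B * K) (Rx + Kᵀ * Ru * K) V) (hRu : Ru.PosDef) :
    V - P = (A + B * K)ᵀ * (V - P) * (A + B * K) +
      (gain Ru A B P - K)ᵀ * (Ru + Bᵀ * P * B) * (gain Ru A B P - K) := by
  have hP := policyMap_eq_riccatiMap_add hRu h.nonneg Rx A B K
  rw [(isDARESolution_iff.1 h).2, ← neg_sub, Matrix.transpose_neg, Matrix.neg_mul,
    Matrix.mul_neg, Matrix.neg_mul, neg_neg] at hP
  nth_rw 1 [hV.2]
  rw [← sub_eq_iff_eq_add'.2 hP, policyMap, lyapunovMap, Matrix.mul_sub, Matrix.sub_mul]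
  abel

theorem IsDARESolution.exists_value_sub_eq_transpose_mul_self (h : IsDARESolution Rx Ru A B P)
    (hV : IsLyapunovSolution (A + B * K) (Rx + Kᵀ * Ru * K) V) (hRx : 1 ≤ Rx) (hRu : Ru.PosDef)
    (hT : Tᵀ * T = Ru + Bᵀ * P * B) :
    ∃ Z : Matrix (Fin dx) (Fin dx) ℝ, V - P = Zᵀ * Z ∧
      Zᵀ * Z = (Z * (A + B * K))ᵀ * (Z * (A + B * K)) +
        (T * (gain Ru A B P - K))ᵀ * (T * (gain Ru A B P - K)) := by
  obtain ⟨Z, hZ⟩ := exists_eq_transpose_mul_self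
    (sub_nonneg.2 (h.le_of_isLyapunovSolution hV hRx hRu))
  refine ⟨Z, hZ, ?_⟩
  have hsub := h.value_sub_eq hV hRu
  rw [hZ, ← hT] at hsub
  rw [hsub, Matrix.transpose_mul Z, Matrix.transpose_mul T]
  simp only [Matrix.mul_assoc]

theorem IsDARESolution.opNorm_value_sub_le (h : IsDARESolution Rx Ru A B P)
    (hV : IsLyapunovSolution (A + B * K) (Rx + Kᵀ * Ru * K) V) (hRx : 1 ≤ Rx) (hRu : Ru.PosDef)
    (hT : Tᵀ * T = Ru + Bᵀ * P * B) {p : ℝ} (hp : 1 ≤ p) (hVp : opNorm V ≤ p) :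
    opNorm (V - P) ≤ p ^ 2 * opNorm (T * (gain Ru A B P - K)) ^ 2 := by
  obtain ⟨Z, hZ, hrec⟩ := h.exists_value_sub_eq_transpose_mul_self hV hRx hRu hT
  rw [hZ, opNorm_transpose_mul_self]
  exact isQNorm_opNorm.sq_le_of_isLyapunovSolution hV
    (one_le_policyCost hRx hRu.posSemidef.nonneg K) hp hVp hrec

theorem IsDARESolution.trace_value_sub_le (h : IsDARESolution Rx Ru A B P)
    (hV : IsLyapunovSolution (A + B * K) (Rx + Kᵀ * Ru * K) V) (hRx : 1 ≤ Rx) (hRu : Ru.PosDef)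
    (hT : Tᵀ * T = Ru + Bᵀ * P * B) {p : ℝ} (hp : 1 ≤ p) (hVp : opNorm V ≤ p) :
    V.trace - P.trace ≤ p ^ 2 * frobNorm (T * (gain Ru A B P - K)) ^ 2 := by
  obtain ⟨Z, hZ, hrec⟩ := h.exists_value_sub_eq_transpose_mul_self hV hRx hRu hT
  rw [← Matrix.trace_sub, hZ, ← frobNorm_sq]
  exact isQNorm_frobNorm.sq_le_of_isLyapunovSolution hV
    (one_le_policyCost hRx hRu.posSemidef.nonneg K) hp hVp hrec

end Suboptimality

section SmallPerturbation

/-- `(A', B')` lies in the neighbourhood of `(A, B)` on which the perturbation bounds hold. Here `p`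
stands for the spectral norm of the value matrix of `(A, B)`. -/
structure IsSmallPerturbation {dx du : ℕ} (p ε : ℝ) (A : Matrix (Fin dx) (Fin dx) ℝ)
    (B : Matrix (Fin dx) (Fin du) ℝ) (A' : Matrix (Fin dx) (Fin dx) ℝ)
    (B' : Matrix (Fin dx) (Fin du) ℝ) : Prop where
  one_le : 1 ≤ p
  opNorm_sub_left_le : opNorm (A' - A) ≤ ε
  opNorm_sub_right_le : opNorm (B' - B) ≤ ε
  le : ε ≤ 1 / (54 * p ^ 5)

variable {dx du : ℕ} {Rx A A' P P' V : Matrix (Fin dx) (Fin dx) ℝ}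
  {Ru : Matrix (Fin du) (Fin du) ℝ} {B B' : Matrix (Fin dx) (Fin du) ℝ} {p ε : ℝ}

namespace IsSmallPerturbation

theorem nonneg (hs : IsSmallPerturbation p ε A B A' B') : 0 ≤ ε :=
  (opNorm_nonneg _).trans hs.opNorm_sub_left_le

theorem pow_mul_le (hs : IsSmallPerturbation p ε A B A' B') {k : ℕ} (hk : k ≤ 5) :
    p ^ k * ε ≤ 1 / 54 := by
  have hp : 0 < p := one_pos.trans_le hs.one_le
  have hε := hs.le
  rw [le_div_iff₀ (by positivity)] at hε
  linarith [mul_le_mul_of_nonneg_right (pow_le_pow_right₀ hs.one_le hk) hs.nonneg]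

theorem pow_mul_sq_le (hs : IsSmallPerturbation p ε A B A' B') {k : ℕ} (hk : k ≤ 5) :
    p ^ (2 * k) * ε ^ 2 ≤ 1 / 2916 := by
  have hp : 0 < p := one_pos.trans_le hs.one_le
  have hε := hs.nonneg
  calc p ^ (2 * k) * ε ^ 2 = (p ^ k * ε) ^ 2 := by ring
    _ ≤ (1 / 54) ^ 2 := pow_le_pow_left₀ (by positivity) (hs.pow_mul_le hk) 2
    _ = 1 / 2916 := by norm_num

theorem sq_mul_le (hs : IsSmallPerturbation p ε A B A' B') :
    p ^ 2 * ε ≤ 1 / (54 * p ^ (3 / 2 : ℝ)) := by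
  have hp : 0 < p := one_pos.trans_le hs.one_le
  have hε := hs.nonneg
  have hrpow : p ^ (3 / 2 : ℝ) ≤ p ^ 3 := by
    rw [← Real.rpow_natCast]
    exact Real.rpow_le_rpow_of_exponent_le hs.one_le (by norm_num)
  rw [le_div_iff₀ (by positivity)]
  calc p ^ 2 * ε * (54 * p ^ (3 / 2 : ℝ)) ≤ p ^ 2 * ε * (54 * p ^ 3) := by gcongr
    _ = 54 * (p ^ 5 * ε) := by ring
    _ ≤ 1 := by linarith [hs.pow_mul_le le_rfl]

theorem exists_isDARESolution (hs : IsSmallPerturbation p ε A B A' B')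
    (h : IsDARESolution Rx Ru A B P) (hP : opNorm P ≤ p) (hRx : 1 ≤ Rx) (hRu : 1 ≤ Ru) :
    ∃ P', IsDARESolution Rx Ru A' B' P' ∧ opNorm P' ≤ 1.0835 * p := by
  have hε := hs.pow_mul_le (k := 2) (by norm_num)
  have hεsq := hs.pow_mul_sq_le (k := 1) (by norm_num)
  have hU0 := smul_nonneg (by norm_num : (0 : ℝ) ≤ (1 - 220 / 2916)⁻¹) h.nonneg
  have hU := h.policyMap_smul_le (δ := 220 / 2916) hRx hRu hs.one_le hP hs.opNorm_sub_left_le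
    hs.opNorm_sub_right_le (by norm_num) (by linarith)
  obtain ⟨P', hP', hle, -⟩ :=
    exists_isDARESolution_of_le (zero_le_one.trans hRx) (posDef_of_one_le hRu) hU0 hU
  refine ⟨P', hP', (opNorm_mono hP'.nonneg hle).trans ?_⟩
  rw [opNorm_smul, abs_of_pos (by norm_num)]
  exact mul_le_mul (by norm_num) hP (opNorm_nonneg P) (by norm_num)

theorem opNorm_le (hs : IsSmallPerturbation p ε A B A' B') (h : IsDARESolution Rx Ru A B P)
    (hP : opNorm P ≤ p) (hRx : 1 ≤ Rx) (hRu : 1 ≤ Ru) (h' : IsDARESolution Rx Ru A' B' P') :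
    opNorm P' ≤ 1.0835 * p := by
  obtain ⟨Q, hQ, hle⟩ := hs.exists_isDARESolution h hP hRx hRu
  rwa [h'.eq hQ hRx (posDef_of_one_le hRu)]

theorem exists_isLyapunovSolution (hs : IsSmallPerturbation p ε A B A' B')
    (h : IsDARESolution Rx Ru A B P) (hP : opNorm P ≤ p) (hRx : 1 ≤ Rx) (hRu : 1 ≤ Ru)
    (h' : IsDARESolution Rx Ru A' B' P') :
    ∃ V, IsLyapunovSolution (A + B * gain Ru A' B' P')
      (Rx + (gain Ru A' B' P')ᵀ * Ru * gain Ru A' B' P') V ∧ opNorm V ≤ 1.2 * p := by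
  have hp := hs.one_le
  have hP' := hs.opNorm_le h hP hRx hRu h'
  have hε := hs.pow_mul_le (k := 2) (by norm_num)
  have hεsq := hs.pow_mul_sq_le (k := 1) (by norm_num)
  have hU0 := smul_nonneg (by norm_num : (0 : ℝ) ≤ (1 - 0.0887)⁻¹) h'.nonneg
  have hU := h'.policyMap_smul_le (A' := A) (B' := B) (δ := 0.0887) hRx hRu (by linarith) hP'
    ((opNorm_sub_rev _ _).trans_le hs.opNorm_sub_left_le)
    ((opNorm_sub_rev _ _).trans_le hs.opNorm_sub_right_le) (by norm_num)
    (by rw [mul_pow]; linarith)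
  obtain ⟨V, hV, hle, -⟩ := exists_isLyapunovSolution_of_le
    (add_nonneg (zero_le_one.trans hRx) (transpose_mul_mul_nonneg (zero_le_one.trans hRu) _))
    hU0 hU
  refine ⟨V, hV, (opNorm_mono hV.nonneg hle).trans ?_⟩
  rw [opNorm_smul, abs_of_pos (by norm_num)]
  calc (1 - 0.0887)⁻¹ * opNorm P' ≤ 1.0975 * (1.0835 * p) :=
        mul_le_mul (by norm_num) hP' (opNorm_nonneg P') (by norm_num)
    _ ≤ 1.2 * p := by linarith

theorem opNorm_le_of_isLyapunovSolution (hs : IsSmallPerturbation p ε A B A' B')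
    (h : IsDARESolution Rx Ru A B P) (hP : opNorm P ≤ p) (hRx : 1 ≤ Rx) (hRu : 1 ≤ Ru)
    (h' : IsDARESolution Rx Ru A' B' P')
    (hV : IsLyapunovSolution (A + B * gain Ru A' B' P')
      (Rx + (gain Ru A' B' P')ᵀ * Ru * gain Ru A' B' P') V) : opNorm V ≤ 1.2 * p := by
  obtain ⟨W, hW, hle⟩ := hs.exists_isLyapunovSolution h hP hRx hRu h'
  have hY := one_le_policyCost hRx (zero_le_one.trans hRu) (gain Ru A' B' P')
  rwa [hV.eq hW (hV.isStable hY)]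

theorem mul_gain_sub_le {N : ∀ {a b : ℕ}, Matrix (Fin a) (Fin b) ℝ → ℝ}
    (hN : IsOperatorIdealNorm N) (hs : IsSmallPerturbation p ε A B A' B')
    (h : IsDARESolution Rx Ru A B P) (hP : opNorm P ≤ p) (hRx : 1 ≤ Rx) (hRu : 1 ≤ Ru)
    (h' : IsDARESolution Rx Ru A' B' P') {e : ℝ} (hA : N (A' - A) ≤ e) (hB : N (B' - B) ≤ e)
    {T : Matrix (Fin du) (Fin du) ℝ} (hT : Tᵀ * T = Ru + Bᵀ * P * B) :
    N (T * (gain Ru A B P - gain Ru A' B' P')) ≤ 8.3 * p ^ 2 * e := by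
  have hp := hs.one_le
  have he : 0 ≤ p ^ 2 * e := mul_nonneg (sq_nonneg p) ((hN.nonneg _).trans hA)
  have hgain := hN.mul_gain_sub_le_of_opNorm_le h h' hRx hRu (q := 1.0835 * p) (by linarith)
    (by linarith) (hs.opNorm_le h hP hRx hRu h') hA hB hT
  rw [mul_pow] at hgain
  linarith

theorem opNorm_mul_gain_sub_lt (hs : IsSmallPerturbation p ε A B A' B')
    (h : IsDARESolution Rx Ru A B P) (hP : opNorm P ≤ p) (hRx : 1 ≤ Rx) (hRu : 1 ≤ Ru)
    (h' : IsDARESolution Rx Ru A' B' P') {a : ℕ} {X : Matrix (Fin a) (Fin du) ℝ}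
    (hX : Xᵀ * X ≤ Ru + Bᵀ * P * B) :
    opNorm (X * (gain Ru A B P - gain Ru A' B' P')) < 1 / (5 * p ^ (3 / 2 : ℝ)) := by
  obtain ⟨T, hT⟩ := exists_eq_transpose_mul_self
    ((transpose_mul_self_nonneg X).trans hX)
  have hr : 0 < p ^ (3 / 2 : ℝ) := Real.rpow_pos_of_pos (one_pos.trans_le hs.one_le) _
  calc opNorm (X * (gain Ru A B P - gain Ru A' B' P'))
      ≤ opNorm (T * (gain Ru A B P - gain Ru A' B' P')) :=
        opNorm_mul_le_opNorm_mul (hX.trans_eq hT) _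
    _ ≤ 8.3 * p ^ 2 * ε := hs.mul_gain_sub_le isOperatorIdealNorm_opNorm h hP hRx hRu h'
        hs.opNorm_sub_left_le hs.opNorm_sub_right_le hT.symm
    _ ≤ 8.3 * (1 / (54 * p ^ (3 / 2 : ℝ))) := by linarith [hs.sq_mul_le]
    _ < 1 / (5 * p ^ (3 / 2 : ℝ)) := by
        rw [mul_one_div, div_lt_div_iff₀ (by positivity) (by positivity)]
        linarith

theorem sq_mul_sq_le (hs : IsSmallPerturbation p ε A B A' B') {x e : ℝ} (hx : 0 ≤ x)
    (hxe : x ≤ 8.3 * p ^ 2 * e) : (1.2 * p) ^ 2 * x ^ 2 ≤ 142 * p ^ 8 * e ^ 2 := calc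
  (1.2 * p) ^ 2 * x ^ 2 ≤ (1.2 * p) ^ 2 * (8.3 * p ^ 2 * e) ^ 2 := by gcongr
  _ = 1.2 ^ 2 * 8.3 ^ 2 * (p ^ 6 * e ^ 2) := by ring
  _ ≤ 142 * (p ^ 8 * e ^ 2) := by
    have := hs.one_le
    gcongr <;> norm_num
  _ = 142 * p ^ 8 * e ^ 2 := by ring

theorem opNorm_value_sub_le (hs : IsSmallPerturbation p ε A B A' B')
    (h : IsDARESolution Rx Ru A B P) (hP : opNorm P ≤ p) (hRx : 1 ≤ Rx) (hRu : 1 ≤ Ru)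
    (h' : IsDARESolution Rx Ru A' B' P')
    (hV : IsLyapunovSolution (A + B * gain Ru A' B' P')
      (Rx + (gain Ru A' B' P')ᵀ * Ru * gain Ru A' B' P') V) :
    opNorm (V - P) ≤ 142 * p ^ 8 * ε ^ 2 := by
  have hRu' := posDef_of_one_le hRu
  have hp := hs.one_le
  obtain ⟨T, hT⟩ :=
    exists_eq_transpose_mul_self (posDef_inputCost hRu' h.nonneg B).posSemidef.nonneg
  exact (h.opNorm_value_sub_le hV hRx hRu' hT.symm (by linarith)
    (hs.opNorm_le_of_isLyapunovSolution h hP hRx hRu h' hV)).trans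
    (hs.sq_mul_sq_le (opNorm_nonneg _) (hs.mul_gain_sub_le isOperatorIdealNorm_opNorm h hP hRx hRu
      h' hs.opNorm_sub_left_le hs.opNorm_sub_right_le hT.symm))

theorem trace_value_sub_le (hs : IsSmallPerturbation p ε A B A' B')
    (h : IsDARESolution Rx Ru A B P) (hP : opNorm P ≤ p) (hRx : 1 ≤ Rx) (hRu : 1 ≤ Ru)
    (h' : IsDARESolution Rx Ru A' B' P')
    (hV : IsLyapunovSolution (A + B * gain Ru A' B' P')
      (Rx + (gain Ru A' B' P')ᵀ * Ru * gain Ru A' B' P') V) {e : ℝ} (hA : frobNorm (A' - A) ≤ e)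
    (hB : frobNorm (B' - B) ≤ e) : V.trace - P.trace ≤ 142 * p ^ 8 * e ^ 2 := by
  have hRu' := posDef_of_one_le hRu
  have hp := hs.one_le
  obtain ⟨T, hT⟩ :=
    exists_eq_transpose_mul_self (posDef_inputCost hRu' h.nonneg B).posSemidef.nonneg
  exact (h.trace_value_sub_le hV hRx hRu' hT.symm (by linarith)
    (hs.opNorm_le_of_isLyapunovSolution h hP hRx hRu h' hV)).trans
    (hs.sq_mul_sq_le (frobNorm_nonneg _) (hs.mul_gain_sub_le isOperatorIdealNorm_frobNorm h hP hRx
      hRu h' hA hB hT.symm))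

theorem value_le_smul (hs : IsSmallPerturbation p ε A B A' B')
    (h : IsDARESolution Rx Ru A B P) (hP : opNorm P ≤ p) (hRx : 1 ≤ Rx) (hRu : 1 ≤ Ru)
    (h' : IsDARESolution Rx Ru A' B' P')
    (hV : IsLyapunovSolution (A + B * gain Ru A' B' P')
      (Rx + (gain Ru A' B' P')ᵀ * Ru * gain Ru A' B' P') V) : V ≤ (21 / 20 : ℝ) • P := by
  have hsymm : (V - P)ᵀ = V - P := by
    rw [Matrix.transpose_sub, transpose_eq_of_nonneg hV.nonneg, transpose_eq_of_nonneg h.nonneg]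
  have hnorm : opNorm (V - P) ≤ 1 / 20 := by
    linarith [hs.opNorm_value_sub_le h hP hRx hRu h' hV, hs.pow_mul_sq_le (k := 4) (by norm_num)]
  rw [show (21 / 20 : ℝ) = 1 / 20 + 1 by norm_num, add_smul, one_smul, ← sub_le_iff_le_add]
  calc V - P ≤ opNorm (V - P) • 1 := le_opNorm_smul_one hsymm
    _ ≤ (1 / 20 : ℝ) • 1 := smul_le_smul_of_nonneg_right hnorm zero_le_one
    _ ≤ (1 / 20 : ℝ) • P :=
        smul_le_smul_of_nonneg_left (hRx.trans (h.le (posDef_of_one_le hRu))) (by norm_num)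

end IsSmallPerturbation

end SmallPerturbation

end LQR

open LQR MatrixOrder in
theorem theorem3_general :
    ∃ C : ℝ, 0 < C ∧
      ∀ (dx du : ℕ) (_ : 0 < dx)
        (Rx : Matrix (Fin dx) (Fin dx) ℝ) (_ : LQR.LoewnerLE 1 Rx)
        (Ru : Matrix (Fin du) (Fin du) ℝ) (_ : LQR.LoewnerLE 1 Ru)
        (As Ah : Matrix (Fin dx) (Fin dx) ℝ) (Bs Bh : Matrix (Fin dx) (Fin du) ℝ)
        (Ps Ph : Matrix (Fin dx) (Fin dx) ℝ) (Ks Kh : Matrix (Fin du) (Fin dx) ℝ)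
        (eop eF : ℝ)
        (_ : Ps = LQR.Pinf Rx Ru As Bs) (_ : Ks = LQR.Kinf Rx Ru As Bs)
        (_ : Ph = LQR.Pinf Rx Ru Ah Bh) (_ : Kh = LQR.Kinf Rx Ru Ah Bh)
        (_ : eop = max (LQR.opNorm (Ah - As)) (LQR.opNorm (Bh - Bs)))
        (_ : eF = max (LQR.frobNorm (Ah - As)) (LQR.frobNorm (Bh - Bs)))
        (_ : LQR.Stabilizable As Bs)
        (_ : eop ≤ 1 / (54 * LQR.opNorm Ps ^ 5)),
        (∃! P, LQR.IsDARESolution Rx Ru As Bs P) ∧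
        LQR.Stabilizable Ah Bh ∧
        (∃! P, LQR.IsDARESolution Rx Ru Ah Bh P) ∧
        LQR.IsStable (As + Bs * Kh) ∧
        (∃! P, LQR.IsLyapunovSolution (As + Bs * Kh) (Rx + Khᵀ * Ru * Kh) P) ∧
        LQR.opNorm Ph ≤ 1.0835 * LQR.opNorm Ps ∧
        LQR.opNorm (Bs * (Ks - Kh)) < 1 / (5 * LQR.opNorm Ps ^ (3 / 2 : ℝ)) ∧
        LQR.opNorm (Ks - Kh) ≤ C * (1 / LQR.opNorm Ps ^ (3 / 2 : ℝ)) ∧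
        (∃ J Jstar : ℝ, LQR.HasAverageCost Rx Ru As Bs Kh J ∧
          LQR.IsOptimalCost Rx Ru As Bs Jstar ∧
          J - Jstar ≤ 142 * LQR.opNorm Ps ^ 8 * eF ^ 2) ∧
        LQR.opNorm (LQR.PinfOf Rx Ru As Bs Kh - Ps) ≤ 142 * LQR.opNorm Ps ^ 8 * eop ^ 2 ∧
        LQR.LoewnerLE (LQR.PinfOf Rx Ru As Bs Kh) ((21 / 20 : ℝ) • Ps) := by
  refine ⟨1 / 5, by norm_num, ?_⟩
  rintro dx du hdx Rx (hRx : 1 ≤ Rx) Ru (hRu : 1 ≤ Ru) As Ah Bs Bh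
    _ _ _ _ eop eF rfl rfl rfl rfl heop heF hstab hsmall
  have : NeZero dx := ⟨hdx.ne'⟩
  have hRu' := posDef_of_one_le hRu
  have hP := isDARESolution_Pinf (hstab.exists_isDARESolution (zero_le_one.trans hRx) hRu')
  have hP1 := hRx.trans (hP.le hRu')
  have hs : IsSmallPerturbation (opNorm (Pinf Rx Ru As Bs)) eop As Bs Ah Bh :=
    ⟨one_le_opNorm hP1, heop ▸ le_max_left _ _, heop ▸ le_max_right _ _, hsmall⟩
  have hP' := isDARESolution_Pinf
    ((hs.exists_isDARESolution hP le_rfl hRx hRu).imp fun _ h => h.1)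
  have hV := isLyapunovSolution_dlyap
    ((hs.exists_isLyapunovSolution hP le_rfl hRx hRu hP').imp fun _ h => h.1)
  have hY := one_le_policyCost hRx (zero_le_one.trans hRu) (Kinf Rx Ru Ah Bh)
  have hgain := hs.opNorm_mul_gain_sub_lt hP le_rfl hRx hRu hP'
    (X := (1 : Matrix (Fin du) (Fin du) ℝ))
    (by rw [Matrix.transpose_one, Matrix.one_mul]; exact one_le_inputCost hRu hP.nonneg Bs)
  rw [Matrix.one_mul, ← one_div_mul_one_div] at hgain
  exact ⟨⟨_, hP, fun _ h => h.eq hP hRx hRu'⟩, hP'.stabilizable hRx hRu',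
    ⟨_, hP', fun _ h => h.eq hP' hRx hRu'⟩, hV.isStable hY,
    ⟨_, hV, fun _ h => h.eq hV (h.isStable hY)⟩, hs.opNorm_le hP le_rfl hRx hRu hP',
    hs.opNorm_mul_gain_sub_lt hP le_rfl hRx hRu hP'
      (transpose_mul_self_le_inputCost (zero_le_one.trans hRu) hP1 Bs),
    hgain.le, ⟨_, _, hasAverageCost_of_isLyapunovSolution hRx (zero_le_one.trans hRu) hV,
      hP.isOptimalCost hRx hRu', hs.trace_value_sub_le hP le_rfl hRx hRu hP' hV
        (heF ▸ le_max_left _ _) (heF ▸ le_max_right _ _)⟩,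
    hs.opNorm_value_sub_le hP le_rfl hRx hRu hP' hV, hs.value_le_smul hP le_rfl hRx hRu hP' hV⟩

theorem theorem3 :
    ∃ C : ℝ, 0 < C ∧
      ∀ (dx du : ℕ) (_ : 0 < dx)
        (Rx : Matrix (Fin dx) (Fin dx) ℝ) (_ : LQR.LoewnerLE 1 Rx)
        (Ru : Matrix (Fin du) (Fin du) ℝ) (_ : Ru = 1)
        (As Ah : Matrix (Fin dx) (Fin dx) ℝ) (Bs Bh : Matrix (Fin dx) (Fin du) ℝ)
        (Ps Ph : Matrix (Fin dx) (Fin dx) ℝ) (Ks Kh : Matrix (Fin du) (Fin dx) ℝ)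
        (eop eF : ℝ)
        (_ : Ps = LQR.Pinf Rx Ru As Bs) (_ : Ks = LQR.Kinf Rx Ru As Bs)
        (_ : Ph = LQR.Pinf Rx Ru Ah Bh) (_ : Kh = LQR.Kinf Rx Ru Ah Bh)
        (_ : eop = max (LQR.opNorm (Ah - As)) (LQR.opNorm (Bh - Bs)))
        (_ : eF = max (LQR.frobNorm (Ah - As)) (LQR.frobNorm (Bh - Bs)))
        (_ : LQR.Stabilizable As Bs)
        (_ : eop ≤ 1 / (54 * LQR.opNorm Ps ^ 5)),
        -- all objects below are well defined
        (∃! P, LQR.IsDARESolution Rx Ru As Bs P) ∧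
        LQR.Stabilizable Ah Bh ∧
        (∃! P, LQR.IsDARESolution Rx Ru Ah Bh P) ∧
        LQR.IsStable (As + Bs * Kh) ∧
        (∃! P, LQR.IsLyapunovSolution (As + Bs * Kh) (Rx + Khᵀ * Ru * Kh) P) ∧
        -- the perturbation of the Riccati solution and of the controller
        LQR.opNorm Ph ≤ 1.0835 * LQR.opNorm Ps ∧
        LQR.opNorm (Bs * (Ks - Kh)) < 1 / (5 * LQR.opNorm Ps ^ (3 / 2 : ℝ)) ∧
        LQR.opNorm (Ks - Kh) ≤ C * (1 / LQR.opNorm Ps ^ (3 / 2 : ℝ)) ∧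
        -- the suboptimality of the certainty-equivalent controller
        (∃ J Jstar : ℝ, LQR.HasAverageCost Rx Ru As Bs Kh J ∧
          LQR.IsOptimalCost Rx Ru As Bs Jstar ∧
          J - Jstar ≤ 142 * LQR.opNorm Ps ^ 8 * eF ^ 2) ∧
        -- the perturbation of the value matrix
        LQR.opNorm (LQR.PinfOf Rx Ru As Bs Kh - Ps) ≤ 142 * LQR.opNorm Ps ^ 8 * eop ^ 2 ∧
        LQR.LoewnerLE (LQR.PinfOf Rx Ru As Bs Kh) ((21 / 20 : ℝ) • Ps) := by
  obtain ⟨C, hC, h⟩ := theorem3_general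
  exact ⟨C, hC, fun dx du hdx Rx hRx Ru hRu =>
    h dx du hdx Rx hRx Ru (by simp [hRu, LQR.LoewnerLE, Matrix.PosSemidef.zero])⟩
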